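/- **Theorem (Deformation functor vs. reduction).** Let $k$ be a commutative ring with $\mathbb{Q}\subseteq k$. A DGLA is a $\mathbb{Z}$-graded differential graded Lie algebra over $k$ with differential of degree $1$; morphisms are the degree $0$ linear maps compatible with differentials and brackets. *DGLAs.* For a DGLA $\mathfrak{g}$ let $MC(\mathfrak{g})=\{\xi\in\mathfrak{g}^1 : d\xi+\tfrac12[\xi,\xi]=0\}$. Let $\lambda\mathfrak{g}[[\lambda]]$ be the DGLA of formal power series in $\lambda$ without constant term, with $\lambda$-linearly extended structure maps. Let $G(\mathfrak{g})$ be the group $\lambda\mathfrak{g}^0[[\lambda]]$ with multiplication given by the Baker–Campbell–Hausdorff (BCH) series $a\bullet b=a+b+\tfrac12[a,b]+\cdots$. It acts on $MC(\lambda\mathfrak{g}[[\lambda]])$ by $$a\triangleright\xi=e^{\operatorname{ad}a}(\xi)-\sum_{j\ge 0}\frac{(\operatorname{ad}a)^j}{(j+1)!}(da).$$ Let $Def(\mathfrak{g})=MC(\lambda\mathfrak{g}[[\lambda]])/G(\mathfrak{g})$ be the set of orbits. These give functors $MC, Def:\mathrm{DGLA}\to\mathrm{Set}$ and $G:\mathrm{DGLA}\to\mathrm{Grp}$.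 *Constraint objects.* - A constraint set consists of sets $M_T,M_N$, a map $\iota:M_N\to M_T$ and an equivalence relation $\sim$ on $M_N$; its reduction is $M_N/{\sim}$. - A constraint group consists of a group homomorphism $\iota:\Gamma_N\to \Gamma_T$ and a normal subgroup $\Gamma_0\trianglelefteq \Gamma_N$; its reduction is $\Gamma_N/\Gamma_0$. - A constraint DGLA consists of a DGLA morphism $\iota:\mathfrak{g}_N\to\mathfrak{g}_T$ and a graded Lie ideal $\mathfrak{g}_0\subseteq\mathfrak{g}_N$ with $d\mathfrak{g}_0\subseteq\mathfrak{g}_0$; its reduction is the DGLA $\mathfrak{g}_N/\mathfrak{g}_0$. Morphisms are pairs of structure preserving maps of the $T$- and $N$-components which commute with the maps $\iota$ and preserve $\sim$, respectively the $0$-components. Reduction is a functor $\mathrm{red}$ in all three cases: $\mathrm{ConSet}\to\mathrm{Set}$, $\mathrm{ConGrp}\to\mathrm{Grp}$ and $\mathrm{ConDGLA}\to\mathrm{DGLA}$. *Constraint functors.* For a constraint DGLA $\mathfrak{g}$, let - $MC(\mathfrak{g})$ be the constraint set $(MC(\mathfrak{g}_T),MC(\mathfrak{g}_N),\sim)$ with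 $\xi\sim\eta\iff\xi-\eta\in\mathfrak{g}_0^1$; - $G(\mathfrak{g})$ be the constraint group $(G(\mathfrak{g}_T),G(\mathfrak{g}_N),\lambda\mathfrak{g}_0^0[[\lambda]])$; - $Def(\mathfrak{g})$ be the orbit space of the action of $G(\mathfrak{g})$ on $MC(\lambda\mathfrak{g}[[\lambda]])$, where $\lambda\mathfrak{g}[[\lambda]]=(\lambda\mathfrak{g}_T[[\lambda]],\lambda\mathfrak{g}_N[[\lambda]],\lambda\mathfrak{g}_0[[\lambda]])$: this is the constraint set $(Def(\mathfrak{g}_T),Def(\mathfrak{g}_N),\sim)$ in which two orbits in $Def(\mathfrak{g}_N)$ are equivalent if and only if they have representatives $\xi,\eta\in MC(\lambda\mathfrak{g}_N[[\lambda]])$ with $\xi-\eta\in\lambda\mathfrak{g}_0^1[[\lambda]]$. These are functors $MC, Def:\mathrm{ConDGLA}\to\mathrm{ConSet}$ and $G:\mathrm{ConDGLA}\to\mathrm{ConGrp}$; morphisms act componentwise, extended $\lambda$-linearly for $G$ and $Def$. The following hold. 1. There exists a natural transformation $\eta:\mathrm{red}\circ MC\Rightarrow MC\circ\mathrm{red}$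 of functors $\mathrm{ConDGLA}\to\mathrm{Set}$ all of whose components are injective. 2. There exists a natural isomorphism $\mathrm{red}\circ G\cong G\circ\mathrm{red}$ of functors $\mathrm{ConDGLA}\to\mathrm{Grp}$. 3. There exists a natural transformation $\eta:\mathrm{red}\circ Def\Rightarrow Def\circ\mathrm{red}$ of functors $\mathrm{ConDGLA}\to\mathrm{Set}$ all of whose components are injective. -/

import Mathlib

namespace ConDef
open Polynomial

/-! ### Exponential and logarithm of (nilpotent) elements -/

/-- the truncated series `log (1 + X) = X - X ^ 2 / 2 + X ^ 3 / 3 - ⋯`, up to `X ^ N` -/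
noncomputable def logPoly (N : ℕ) : ℚ[X] :=
  ∑ k ∈ Finset.Icc 1 N, C ((-1 : ℚ) ^ (k - 1) / k) * X ^ k

noncomputable def expPoly (N : ℕ) : ℚ[X] :=
  ∑ k ∈ Finset.range (N + 1), C ((k.factorial : ℚ)⁻¹) * X ^ k

lemma derivative_logPoly (N : ℕ) :
    (1 + X) * derivative (logPoly N) = 1 - (-X) ^ N := by
  have h : derivative (logPoly N) = ∑ k ∈ Finset.range N, (-X) ^ k := by
    rw [logPoly, derivative_sum, Finset.range_eq_Ico, Finset.sum_Ico_eq_sum_range]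
    rw [show Finset.Icc 1 N = Finset.Ico 1 (N + 1) from rfl, Finset.sum_Ico_eq_sum_range]
    refine Finset.sum_congr (by simp) fun k _ => ?_
    rw [derivative_C_mul_X_pow, add_tsub_cancel_left, div_mul_cancel₀ _ (by positivity),
      neg_pow (X : ℚ[X]), zero_add]
    simp
  rw [h]
  have := mul_neg_geom_sum (-X : ℚ[X]) N
  rwa [sub_neg_eq_add] at this

lemma derivative_expPoly (N : ℕ) :
    X ^ N ∣ expPoly N - derivative (expPoly N) := by
  have h : derivative (expPoly N) = ∑ k ∈ Finset.range N, C ((k.factorial : ℚ)⁻¹) * X ^ k := by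
    rw [expPoly, derivative_sum, Finset.sum_range_succ']
    simp only [derivative_C_mul_X_pow]
    simp only [Nat.cast_zero, mul_zero, map_zero, zero_mul, add_zero, add_tsub_cancel_right]
    refine Finset.sum_congr rfl fun k _ => ?_
    rw [Nat.factorial_succ]
    congr 2
    push_cast
    field_simp
  rw [h, expPoly, Finset.sum_range_succ, add_sub_cancel_left]
  exact Dvd.intro_left _ rfl

lemma X_dvd_logPoly (N : ℕ) : X ∣ logPoly N :=
  Finset.dvd_sum fun k hk =>
    Dvd.dvd.mul_left (dvd_pow_self X (by have := (Finset.mem_Icc.1 hk).1; omega)) _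

lemma X_dvd_expPoly (N : ℕ) : X ∣ expPoly N - 1 := by
  rw [expPoly, Finset.sum_range_succ']
  simp only [Nat.factorial_zero, Nat.cast_one, inv_one, map_one, pow_zero, mul_one,
    add_sub_cancel_right]
  exact Finset.dvd_sum fun k hk => Dvd.dvd.mul_left (dvd_pow_self X (by omega)) _

lemma comp_dvd_comp {p q : ℚ[X]} (r : ℚ[X]) (h : p ∣ q) : p.comp r ∣ q.comp r := by
  obtain ⟨s, rfl⟩ := h
  exact ⟨s.comp r, mul_comp _ _ _⟩

lemma X_pow_dvd_comp {p r : ℚ[X]} {N : ℕ} (h : X ^ N ∣ p) (hr : X ∣ r) : X ^ N ∣ p.comp r := by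
  refine dvd_trans ?_ (comp_dvd_comp r h)
  rw [X_pow_comp]
  exact pow_dvd_pow_of_dvd hr N

lemma logPoly_comp (N : ℕ) : X ^ (N + 1) ∣ (logPoly N).comp (expPoly N - 1) - X := by
  set e := expPoly N with he
  set F := (logPoly N).comp (e - 1) with hF
  have h1 : X ^ N ∣ derivative (F - X) := by
    have hd : derivative (F - X) = (derivative (logPoly N)).comp (e - 1) * derivative e - 1 := by
      rw [derivative_sub, hF, derivative_comp, derivative_X, derivative_sub, derivative_one,
        sub_zero, mul_comm]
    have h2 : (derivative (logPoly N)).comp (e - 1) * e = 1 - (-(e - 1)) ^ N := by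
      have := congrArg (fun p => p.comp (e - 1)) (derivative_logPoly N)
      simp only [mul_comp, add_comp, one_comp, X_comp, sub_comp, pow_comp, neg_comp] at this
      rw [← this]; ring
    have h3 : derivative (F - X) =
        -((derivative (logPoly N)).comp (e - 1) * (e - derivative e)) - (-(e - 1)) ^ N := by
      rw [hd, mul_sub, h2]; ring
    rw [h3]
    refine dvd_sub ((Dvd.dvd.mul_left (derivative_expPoly N) _).neg_right) ?_
    exact pow_dvd_pow_of_dvd ((X_dvd_expPoly N).neg_right) N
  have h0 : (F - X).coeff 0 = 0 := by
    have : X ∣ F := by simpa using X_pow_dvd_comp (N := 1) (by simpa using X_dvd_logPoly N) (X_dvd_expPoly N)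
    exact X_dvd_iff.1 (dvd_sub this dvd_rfl)
  rw [X_pow_dvd_iff] at h1 ⊢
  intro d hd
  rcases d with _ | d
  · exact h0
  · have := h1 d (by omega)
    rw [coeff_derivative] at this
    exact (mul_eq_zero.1 this).resolve_right (by positivity)

lemma expPoly_comp (N : ℕ) : X ^ (N + 1) ∣ (expPoly N).comp (logPoly N) - (1 + X) := by
  set l := logPoly N with hl
  set M := (expPoly N).comp l with hM
  have h1 : X ^ N ∣ (1 + X) * derivative (M - (1 + X)) - (M - (1 + X)) := by
    have hd : derivative (M - (1 + X)) = (derivative (expPoly N)).comp l * derivative l - 1 := by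
      rw [derivative_sub, hM, derivative_comp, derivative_add, derivative_X, derivative_one,
        zero_add, mul_comm]
    have h3 : (1 + X) * derivative (M - (1 + X)) - (M - (1 + X)) =
        -(expPoly N - derivative (expPoly N)).comp l
          - (derivative (expPoly N)).comp l * (-X) ^ N := by
      rw [hd, sub_comp, ← hM]
      linear_combination (derivative (expPoly N)).comp l * (derivative_logPoly N)
    rw [h3]
    refine dvd_sub (X_pow_dvd_comp (derivative_expPoly N) (X_dvd_logPoly N)).neg_right ?_
    exact Dvd.dvd.mul_left (pow_dvd_pow_of_dvd (dvd_neg.2 dvd_rfl) N) _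
  have h0 : (M - (1 + X)).coeff 0 = 0 := by
    have : X ∣ M - 1 := by
      have := X_pow_dvd_comp (N := 1) (by simpa using X_dvd_expPoly N) (X_dvd_logPoly N)
      simpa [sub_comp] using this
    refine X_dvd_iff.1 ?_
    rw [← sub_sub]
    exact dvd_sub this dvd_rfl
  rw [X_pow_dvd_iff] at h1 ⊢
  intro d
  induction d with
  | zero => intro _; exact h0
  | succ d ih =>
    intro hd
    have h2 := h1 d (by omega)
    have h3 := ih (by omega)
    have h4 : (X * derivative (M - (1 + X))).coeff d = 0 := by
      rcases d with _ | d
      · simp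
      · rw [coeff_X_mul, coeff_derivative, h3, zero_mul]
    rw [coeff_sub, add_mul, one_mul, coeff_add, h3, sub_zero, h4, add_zero, coeff_derivative] at h2
    exact (mul_eq_zero.1 h2).resolve_right (by positivity)

section Nilpotent

variable {A : Type*} [Ring A] [Algebra ℚ A]

lemma aeval_eq_of_dvd {a : A} {N : ℕ} (ha : a ^ N = 0) {p q : ℚ[X]} (h : X ^ N ∣ p - q) :
    aeval a p = aeval a q := by
  obtain ⟨s, hs⟩ := h
  rw [← sub_eq_zero, ← map_sub, hs, map_mul, map_pow, aeval_X, ha, zero_mul]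

lemma aeval_expPoly {a : A} {N : ℕ} (ha : a ^ (N + 1) = 0) :
    aeval a (expPoly N) = IsNilpotent.exp a := by
  rw [IsNilpotent.exp_eq_sum ha, expPoly, map_sum]
  refine Finset.sum_congr rfl fun k _ => ?_
  rw [map_mul, aeval_C, map_pow, aeval_X, Algebra.smul_def]

lemma aeval_pow_eq_zero {a : A} {N : ℕ} (ha : a ^ N = 0) {p : ℚ[X]} (h : X ∣ p) :
    (aeval a p) ^ N = 0 := by
  obtain ⟨s, rfl⟩ := h
  rw [← map_pow, mul_pow, map_mul, map_pow, aeval_X, ha, zero_mul]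

/-- `log (1 + a)`, for `a ^ (N + 1) = 0` -/
noncomputable def nlog (N : ℕ) (a : A) : A := aeval a (logPoly N)

lemma nlog_pow {a : A} {N : ℕ} (ha : a ^ (N + 1) = 0) : nlog N a ^ (N + 1) = 0 :=
  aeval_pow_eq_zero ha (X_dvd_logPoly N)

lemma exp_nlog {a : A} {N : ℕ} (ha : a ^ (N + 1) = 0) : IsNilpotent.exp (nlog N a) = 1 + a := by
  rw [← aeval_expPoly (nlog_pow ha), nlog, ← aeval_comp,
    aeval_eq_of_dvd ha (expPoly_comp N)]
  simp

lemma exp_sub_one_pow {a : A} {N : ℕ} (ha : a ^ (N + 1) = 0) :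
    (IsNilpotent.exp a - 1) ^ (N + 1) = 0 := by
  have := aeval_pow_eq_zero ha (X_dvd_expPoly N)
  rwa [map_sub, map_one, aeval_expPoly ha] at this

lemma nlog_exp {a : A} {N : ℕ} (ha : a ^ (N + 1) = 0) :
    nlog N (IsNilpotent.exp a - 1) = a := by
  have : IsNilpotent.exp a - 1 = aeval a (expPoly N - 1) := by
    rw [map_sub, map_one, aeval_expPoly ha]
  rw [this, nlog, ← aeval_comp, aeval_eq_of_dvd ha (logPoly_comp N), aeval_X]

lemma commute_nlog {a b : A} (h : Commute a b) (N : ℕ) : Commute (nlog N a) (nlog N b) := by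
  have h1 : ∀ c b : A, Commute c b → Commute c (nlog N b) := fun c b hc => by
    rw [nlog, logPoly, map_sum]
    refine Commute.sum_right _ _ _ fun k _ => ?_
    rw [map_mul, aeval_C, map_pow, aeval_X]
    exact (Algebra.commute_algebraMap_right _ c).mul_right (hc.pow_right k)
  exact h1 _ _ (h1 _ _ h.symm).symm

lemma nlog_mul {a b : A} {N : ℕ} (h : Commute a b) (ha : a ^ (N + 1) = 0) (hb : b ^ (N + 1) = 0)
    (hl : (nlog N a + nlog N b) ^ (N + 1) = 0) :
    nlog N ((1 + a) * (1 + b) - 1) = nlog N a + nlog N b := by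
  rw [← exp_nlog ha, ← exp_nlog hb, ← IsNilpotent.exp_add_of_commute (commute_nlog h N)
    ⟨_, nlog_pow ha⟩ ⟨_, nlog_pow hb⟩, nlog_exp hl]

end Nilpotent

/-! ### Homogeneous components of `log (exp (t x) * exp (t y))` -/

section LogExp

open PowerSeries

variable {A B : Type*} [Ring A] [Algebra ℚ A] [Ring B] [Algebra ℚ B]

/-- the formal power series `exp (t x)`, with `t` the formal variable -/
noncomputable def expSeries (x : A) : PowerSeries A :=
  PowerSeries.mk fun n => ((n.factorial : ℚ)⁻¹) • x ^ n

/-- the coefficient of `t ^ n` in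
`log (exp (t x) * exp (t y)) = ∑ k ≥ 1, (-1) ^ (k - 1) / k * (exp (t x) * exp (t y) - 1) ^ k`;
only the terms with `k ≤ n` contribute -/
noncomputable def logExpCoeff (x y : A) (n : ℕ) : A :=
  ∑ k ∈ Finset.Icc 1 n, ((-1 : ℚ) ^ (k - 1) / k) •
    PowerSeries.coeff n ((expSeries x * expSeries y - 1) ^ k)

lemma map_expSeries (f : A →ₐ[ℚ] B) (x : A) :
    PowerSeries.map (f : A →+* B) (expSeries x) = expSeries (f x) := by
  ext n; simp [expSeries]

lemma map_logExpCoeff (f : A →ₐ[ℚ] B) (x y : A) (n : ℕ) :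
    f (logExpCoeff x y n) = logExpCoeff (f x) (f y) n := by
  simp only [logExpCoeff, map_sum, map_smul]
  refine Finset.sum_congr rfl fun k _ => ?_
  rw [← map_expSeries, ← map_expSeries, ← map_mul,
    ← map_one (PowerSeries.map (f : A →+* B)), ← map_sub, ← map_pow, PowerSeries.coeff_map]
  simp

lemma constantCoeff_expSeries (x : A) : PowerSeries.constantCoeff (expSeries x) = 1 := by
  rw [← PowerSeries.coeff_zero_eq_constantCoeff_apply]; simp [expSeries]

lemma constantCoeff_sub_one (x y : A) :
    PowerSeries.constantCoeff (expSeries x * expSeries y - 1) = 0 := by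
  simp [constantCoeff_expSeries]

lemma coeff_pow_eq_zero {f : PowerSeries A} (hf : PowerSeries.constantCoeff f = 0) {n k : ℕ}
    (h : n < k) : PowerSeries.coeff n (f ^ k) = 0 := by
  induction k generalizing n with
  | zero => omega
  | succ k ih =>
    rw [pow_succ, PowerSeries.coeff_mul]
    refine Finset.sum_eq_zero fun p hp => ?_
    rw [Finset.HasAntidiagonal.mem_antidiagonal] at hp
    by_cases h2 : p.2 = 0
    · rw [h2, PowerSeries.coeff_zero_eq_constantCoeff_apply, hf, mul_zero]
    · rw [ih (by omega), zero_mul]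

lemma coeff_nlog {f : PowerSeries A} (hf : PowerSeries.constantCoeff f = 0) {n N : ℕ}
    (h : n ≤ N) : PowerSeries.coeff n (nlog N f) =
      ∑ k ∈ Finset.Icc 1 n, ((-1 : ℚ) ^ (k - 1) / k) • PowerSeries.coeff n (f ^ k) := by
  have h1 : nlog N f = ∑ k ∈ Finset.Icc 1 N, ((-1 : ℚ) ^ (k - 1) / k) • f ^ k := by
    rw [nlog, logPoly, map_sum]
    refine Finset.sum_congr rfl fun k _ => ?_
    rw [map_mul, aeval_C, map_pow, aeval_X, Algebra.smul_def]
  rw [h1, map_sum]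
  symm
  refine Finset.sum_subset_zero_on_sdiff (Finset.Icc_subset_Icc_right h) ?_ ?_
  · intro k hk
    simp only [Finset.mem_sdiff, Finset.mem_Icc] at hk
    rw [PowerSeries.coeff_smul, coeff_pow_eq_zero hf (by omega), smul_zero]
  · intro k _
    rw [PowerSeries.coeff_smul]

lemma coeff_nlog_exp (x y : A) {n N : ℕ} (h : n ≤ N) :
    PowerSeries.coeff n (nlog N (expSeries x * expSeries y - 1)) = logExpCoeff x y n :=
  coeff_nlog (constantCoeff_sub_one x y) h

/-- the congruence `mod t ^ (N + 1)` on power series -/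
def truncCon (A : Type*) [Ring A] (N : ℕ) : RingCon (PowerSeries A) where
  r f g := ∀ n ≤ N, PowerSeries.coeff n f = PowerSeries.coeff n g
  iseqv := ⟨fun _ _ _ => rfl, fun h n hn => (h n hn).symm,
    fun h h' n hn => (h n hn).trans (h' n hn)⟩
  mul' := fun {f f' g g'} h h' n hn => by
    rw [PowerSeries.coeff_mul, PowerSeries.coeff_mul]
    refine Finset.sum_congr rfl fun p hp => ?_
    rw [Finset.HasAntidiagonal.mem_antidiagonal] at hp
    rw [h p.1 (by omega), h' p.2 (by omega)]
  add' := fun {f f' g g'} h h' n hn => by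
    rw [map_add, map_add, h n hn, h' n hn]

lemma trunc_eq {N : ℕ} {f g : PowerSeries A} :
    (truncCon A N).mk' f = (truncCon A N).mk' g ↔
      ∀ n ≤ N, PowerSeries.coeff n f = PowerSeries.coeff n g :=
  (truncCon A N).eq

lemma trunc_pow {N : ℕ} {f : PowerSeries A} (hf : PowerSeries.constantCoeff f = 0) :
    (truncCon A N).mk' f ^ (N + 1) = 0 := by
  rw [← map_pow, ← map_zero (truncCon A N).mk', trunc_eq]
  intro n hn
  rw [coeff_pow_eq_zero hf (by omega), map_zero]

lemma trunc_nlog {N : ℕ} (f : PowerSeries A) :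
    (truncCon A N).mk' (nlog N f) = nlog N ((truncCon A N).mk' f) := by
  have := (Polynomial.aeval_algHom_apply ((truncCon A N).mk'.toRatAlgHom) f (logPoly N))
  exact this.symm

lemma trunc_expSeries {N : ℕ} (x : A) :
    (truncCon A N).mk' (expSeries x) =
      IsNilpotent.exp ((truncCon A N).mk' (PowerSeries.C x * PowerSeries.X)) := by
  rw [IsNilpotent.exp_eq_sum (trunc_pow (N := N) (by simp))]
  have : ∀ k : ℕ, ((k.factorial : ℚ)⁻¹) •
      (truncCon A N).mk' (PowerSeries.C x * PowerSeries.X) ^ k = (truncCon A N).mk'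
        (((k.factorial : ℚ)⁻¹) • (PowerSeries.C (x ^ k) * PowerSeries.X ^ k)) := by
    intro k
    have hc : Commute (PowerSeries.C x) (PowerSeries.X : PowerSeries A) :=
      PowerSeries.commute_X _
    rw [← map_pow, hc.mul_pow, map_rat_smul, map_pow]
  simp only [this]
  rw [← map_sum, trunc_eq]
  intro n hn
  rw [map_sum, Finset.sum_eq_single n]
  · simp [expSeries, PowerSeries.coeff_X_pow, PowerSeries.coeff_C_mul, -map_pow]
  · intro k _ hk
    simp [PowerSeries.coeff_X_pow, PowerSeries.coeff_C_mul, Ne.symm hk, -map_pow]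
  · intro h
    exact absurd (Finset.mem_range.2 (by omega)) h

lemma expSeries_add {x y : A} (h : Commute x y) :
    expSeries (x + y) = expSeries x * expSeries y := by
  ext N
  have hX : ∀ z : A, Commute (PowerSeries.X : PowerSeries A) (PowerSeries.C z) :=
    fun z => (PowerSeries.commute_X _).symm
  have hc : Commute (PowerSeries.C x * PowerSeries.X) (PowerSeries.C y * PowerSeries.X) :=
    ((h.map PowerSeries.C).mul_right (hX x).symm).mul_left
      ((hX y).mul_right (Commute.refl _))
  refine (trunc_eq (N := N)).1 ?_ N le_rfl
  rw [map_mul, trunc_expSeries, trunc_expSeries, trunc_expSeries, map_add, add_mul, map_add,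
    IsNilpotent.exp_add_of_commute (hc.map _) ⟨N + 1, trunc_pow (by simp)⟩
      ⟨N + 1, trunc_pow (by simp)⟩]

lemma commute_expSeries {x y : A} (h : Commute x y) :
    Commute (expSeries x) (expSeries y) := by
  rw [Commute, SemiconjBy, ← expSeries_add h, ← expSeries_add h.symm, add_comm]

lemma logExpCoeff_add {x₁ x₂ y₁ y₂ : A} (hxx : Commute x₁ x₂) (hxy : Commute x₁ y₂)
    (hyx : Commute y₁ x₂) (hyy : Commute y₁ y₂) (n : ℕ) :
    logExpCoeff (x₁ + x₂) (y₁ + y₂) n = logExpCoeff x₁ y₁ n + logExpCoeff x₂ y₂ n := by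
  set a := expSeries x₁ * expSeries y₁ - 1 with ha
  set b := expSeries x₂ * expSeries y₂ - 1 with hb
  have ha0 : PowerSeries.constantCoeff a = 0 := constantCoeff_sub_one _ _
  have hb0 : PowerSeries.constantCoeff b = 0 := constantCoeff_sub_one _ _
  have hab : Commute a b := by
    refine Commute.sub_left (Commute.sub_right ?_ (Commute.one_right _)) (Commute.one_left _)
    exact ((commute_expSeries hxx).mul_right (commute_expSeries hxy)).mul_left
      ((commute_expSeries hyx).mul_right (commute_expSeries hyy))
  have key : expSeries (x₁ + x₂) * expSeries (y₁ + y₂) - 1 = (1 + a) * (1 + b) - 1 := by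
    rw [expSeries_add hxx, expSeries_add hyy, ha, hb, add_sub_cancel, add_sub_cancel,
      mul_assoc, mul_assoc, ← mul_assoc (expSeries x₂), ← mul_assoc (expSeries y₁),
      (commute_expSeries hyx).eq]
  rw [← coeff_nlog_exp _ _ le_rfl, ← coeff_nlog_exp _ _ le_rfl, ← coeff_nlog_exp _ _ le_rfl, key,
    ← ha, ← hb, ← map_add]
  refine (trunc_eq (N := n)).1 ?_ n le_rfl
  rw [trunc_nlog, map_add, trunc_nlog, trunc_nlog]
  rw [map_sub, map_mul, map_add, map_add, map_one]
  refine nlog_mul (hab.map _) (trunc_pow ha0) (trunc_pow hb0) ?_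
  rw [← trunc_nlog, ← trunc_nlog, ← map_add]
  refine trunc_pow ?_
  rw [map_add, ← PowerSeries.coeff_zero_eq_constantCoeff_apply,
    ← PowerSeries.coeff_zero_eq_constantCoeff_apply, coeff_nlog ha0 (Nat.zero_le _),
    coeff_nlog hb0 (Nat.zero_le _)]
  simp

end LogExp
end ConDef

namespace ConDef

section Dynkin

open TensorProduct

variable {L : Type*} [LieRing L] [LieAlgebra ℚ L] {A : Type*} [Ring A] [Algebra ℚ A]

/-- the operator `(v, a) ↦ (⁅z, v⁆ + a z, 0)` -/
noncomputable def prepend : L →ₗ[ℚ] Module.End ℚ (L × ℚ) where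
  toFun z :=
    { toFun := fun p => (⁅z, p.1⁆ + p.2 • z, 0)
      map_add' := fun p q => by
        ext
        · simp only [Prod.fst_add, Prod.snd_add, lie_add, add_smul]; abel
        · simp
      map_smul' := fun c p => by ext <;> simp [mul_smul] }
  map_add' z w := by
    ext p <;> simp
  map_smul' c z := by
    ext p <;> simp

/-- The right-normed bracketing at `x, y`: the linear map from noncommutative polynomials in two
variables to `L` with `a₁ a₂ ⋯ aₙ ↦ ⁅a₁, ⁅a₂, ⋯ ⁅aₙ₋₁, aₙ⁆⁆⁆`, where every letter `aᵢ` stands for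
`x` or for `y` (and `1 ↦ 0`). -/
noncomputable def nest (x y : L) : FreeAlgebra ℚ Bool →ₗ[ℚ] L :=
  (LinearMap.fst ℚ L ℚ) ∘ₗ (LinearMap.applyₗ ((0 : L), (1 : ℚ))) ∘ₗ
    (FreeAlgebra.lift ℚ fun b : Bool => prepend (cond b y x)).toLinearMap

/-- `logExpCoeff X Y n` in the free algebra in `X, Y` -/
noncomputable def bchWord (n : ℕ) : FreeAlgebra ℚ Bool :=
  logExpCoeff (FreeAlgebra.ι ℚ false) (FreeAlgebra.ι ℚ true) n

/-- the component of degree `n ≥ 1` of the Baker-Campbell-Hausdorff series in Dynkin's form: `1 / n`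
times the right-normed bracketing of the component of degree `n` of `log (exp X * exp Y)` -/
noncomputable def bchTerm (x y : L) (n : ℕ) : L :=
  (n : ℚ)⁻¹ • nest x y (bchWord n)

/-- the span of the letters -/
noncomputable def letters : Submodule ℚ (FreeAlgebra ℚ Bool) :=
  Submodule.span ℚ (Set.range (FreeAlgebra.ι ℚ))

lemma logExpCoeff_mem {S : Submodule ℚ A} {x y : A} (hx : x ∈ S) (hy : y ∈ S) (n : ℕ) :
    logExpCoeff x y n ∈ S ^ n := by
  have h1 : ∀ z ∈ S, ∀ n, PowerSeries.coeff n (expSeries z) ∈ S ^ n := fun z hz n => by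
    rw [expSeries, PowerSeries.coeff_mk]
    exact Submodule.smul_mem _ _ (Submodule.pow_mem_pow S hz n)
  have h2 : ∀ f g : PowerSeries A, (∀ n, PowerSeries.coeff n f ∈ S ^ n) →
      (∀ n, PowerSeries.coeff n g ∈ S ^ n) → ∀ n, PowerSeries.coeff n (f * g) ∈ S ^ n := by
    intro f g hf hg n
    rw [PowerSeries.coeff_mul]
    refine Submodule.sum_mem _ fun p hp => ?_
    rw [Finset.HasAntidiagonal.mem_antidiagonal] at hp
    rw [← hp, pow_add]
    exact Submodule.mul_mem_mul (hf _) (hg _)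
  have h3 : ∀ n, PowerSeries.coeff n (1 : PowerSeries A) ∈ S ^ n := by
    intro n
    rw [PowerSeries.coeff_one]
    split_ifs with h
    · subst h; exact Submodule.one_le.1 (by simp)
    · exact Submodule.zero_mem _
  have h4 : ∀ n, PowerSeries.coeff n (expSeries x * expSeries y - 1) ∈ S ^ n := fun n => by
    rw [map_sub]
    exact Submodule.sub_mem _ (h2 _ _ (h1 x hx) (h1 y hy) n) (h3 n)
  have h5 : ∀ k n, PowerSeries.coeff n ((expSeries x * expSeries y - 1) ^ k) ∈ S ^ n := by
    intro k
    induction k with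
    | zero => simpa using h3
    | succ k ih => rw [pow_succ]; exact h2 _ _ ih h4
  exact Submodule.sum_mem _ fun k _ => Submodule.smul_mem _ _ (h5 k n)

/-- the coproduct for which the letters are primitive -/
noncomputable def copr : FreeAlgebra ℚ Bool →ₐ[ℚ] FreeAlgebra ℚ Bool ⊗[ℚ] FreeAlgebra ℚ Bool :=
  FreeAlgebra.lift ℚ fun b => FreeAlgebra.ι ℚ b ⊗ₜ 1 + 1 ⊗ₜ FreeAlgebra.ι ℚ b

lemma copr_bchWord (n : ℕ) : copr (bchWord n) = bchWord n ⊗ₜ 1 + 1 ⊗ₜ bchWord n := by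
  have hc : ∀ a b : FreeAlgebra ℚ Bool, Commute (a ⊗ₜ[ℚ] (1 : FreeAlgebra ℚ Bool))
      ((1 : FreeAlgebra ℚ Bool) ⊗ₜ[ℚ] b) := fun a b => by
    simp [Commute, SemiconjBy]
  have hl := map_logExpCoeff (Algebra.TensorProduct.includeLeft :
    FreeAlgebra ℚ Bool →ₐ[ℚ] FreeAlgebra ℚ Bool ⊗[ℚ] FreeAlgebra ℚ Bool)
    (FreeAlgebra.ι ℚ false) (FreeAlgebra.ι ℚ true) n
  have hr := map_logExpCoeff (Algebra.TensorProduct.includeRight :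
    FreeAlgebra ℚ Bool →ₐ[ℚ] FreeAlgebra ℚ Bool ⊗[ℚ] FreeAlgebra ℚ Bool)
    (FreeAlgebra.ι ℚ false) (FreeAlgebra.ι ℚ true) n
  simp only [Algebra.TensorProduct.includeLeft_apply,
    Algebra.TensorProduct.includeRight_apply] at hl hr
  rw [bchWord, map_logExpCoeff, hl, hr, ← logExpCoeff_add (hc _ _) (hc _ _) (hc _ _) (hc _ _)]
  simp [copr]

variable (φ : L →ₗ[ℚ] A) (x y : L)

noncomputable def evalWord : FreeAlgebra ℚ Bool →ₐ[ℚ] A :=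
  FreeAlgebra.lift ℚ fun b => φ (cond b y x)

noncomputable def counit : FreeAlgebra ℚ Bool →ₐ[ℚ] ℚ := FreeAlgebra.lift ℚ fun _ => 0

noncomputable def dynkinMap : FreeAlgebra ℚ Bool ⊗[ℚ] FreeAlgebra ℚ Bool →ₗ[ℚ] A :=
  LinearMap.mul' ℚ A ∘ₗ
    TensorProduct.map (φ ∘ₗ nest x y) (evalWord φ x y).toLinearMap

noncomputable def evalRight : FreeAlgebra ℚ Bool ⊗[ℚ] FreeAlgebra ℚ Bool →ₐ[ℚ] A :=
  Algebra.TensorProduct.lift ((Algebra.ofId ℚ A).comp counit) (evalWord φ x y)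
    (fun _ _ => Algebra.commutes _ _)

lemma evalRight_tmul (u v : FreeAlgebra ℚ Bool) :
    evalRight φ x y (u ⊗ₜ v) = counit u • evalWord φ x y v :=
  (Algebra.TensorProduct.lift_tmul _ _ _ _ _).trans (Algebra.smul_def _ _).symm

lemma evalRight_copr (a : FreeAlgebra ℚ Bool) : evalRight φ x y (copr a) = evalWord φ x y a := by
  suffices h : (evalRight φ x y).comp copr = evalWord φ x y from congrArg (fun f => f a) h
  ext b
  simp [evalRight, copr, evalWord, counit]

lemma prepend_word (u : FreeAlgebra ℚ Bool) (p : L × ℚ) :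
    ((FreeAlgebra.lift ℚ fun b : Bool => prepend (cond b y x)) u p).2 = counit u * p.2 := by
  induction u using FreeAlgebra.induction generalizing p with
  | grade0 r => simp [counit, Algebra.algebraMap_eq_smul_one]
  | grade1 b => simp [counit, prepend]
  | mul a b ha hb => rw [map_mul, Module.End.mul_apply, ha, hb, map_mul, mul_assoc]
  | add a b ha hb => rw [map_add, LinearMap.add_apply, Prod.snd_add, ha, hb, map_add, add_mul]

lemma nest_one : nest x y 1 = 0 := by simp [nest]

lemma nest_mul (b : Bool) (u : FreeAlgebra ℚ Bool) :
    nest x y (FreeAlgebra.ι ℚ b * u) =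
      ⁅(cond b y x), nest x y u⁆ + counit u • (cond b y x) := by
  have := prepend_word x y u (0, 1)
  rw [mul_one] at this
  rw [← this]
  simp [nest, prepend]

lemma dynkinMap_mul (hφ : ∀ a b, φ ⁅a, b⁆ = φ a * φ b - φ b * φ a) (b : Bool) (w : FreeAlgebra ℚ Bool ⊗[ℚ] FreeAlgebra ℚ Bool) :
    dynkinMap φ x y ((FreeAlgebra.ι ℚ b ⊗ₜ 1 + 1 ⊗ₜ FreeAlgebra.ι ℚ b) * w) =
      φ (cond b y x) * dynkinMap φ x y w + φ (cond b y x) * evalRight φ x y w := by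
  induction w using TensorProduct.induction_on with
  | zero => simp
  | add w w' h h' =>
    rw [mul_add, map_add, h, h', map_add, map_add]
    noncomm_ring
  | tmul u v =>
    have h1 : evalWord φ x y (FreeAlgebra.ι ℚ b) = φ (cond b y x) := by simp [evalWord]
    simp only [add_mul, Algebra.TensorProduct.tmul_mul_tmul, one_mul, map_add, dynkinMap,
      LinearMap.comp_apply, TensorProduct.map_tmul, LinearMap.mul'_apply, nest_mul,
      AlgHom.toLinearMap_apply, map_mul, h1, evalRight_tmul, hφ, map_smul, smul_mul_assoc,
      mul_smul_comm]
    noncomm_ring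

lemma dynkinMap_copr (hφ : ∀ a b, φ ⁅a, b⁆ = φ a * φ b - φ b * φ a) (n : ℕ) (a : FreeAlgebra ℚ Bool) (ha : a ∈ letters ^ n) :
    dynkinMap φ x y (copr a) = (n : ℚ) • evalWord φ x y a := by
  induction n generalizing a with
  | zero =>
    rw [pow_zero, Submodule.mem_one] at ha
    obtain ⟨r, rfl⟩ := ha
    rw [Algebra.algebraMap_eq_smul_one, map_smul, map_smul, map_one,
      Algebra.TensorProduct.one_def]
    simp [dynkinMap, nest_one]
  | succ n ih =>
    rw [pow_succ'] at ha
    refine Submodule.mul_induction_on ha ?_ ?_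
    · intro l hl c hc
      rw [letters] at hl
      induction hl using Submodule.span_induction with
      | mem l hl =>
        obtain ⟨b, rfl⟩ := hl
        have h1 : evalWord φ x y (FreeAlgebra.ι ℚ b) = φ (cond b y x) := by simp [evalWord]
        rw [map_mul, copr, FreeAlgebra.lift_ι_apply, dynkinMap_mul φ x y hφ, ← copr, ih c hc,
          evalRight_copr, map_mul, h1, mul_smul_comm]
        push_cast
        rw [add_smul, one_smul]
      | zero => simp
      | add l l' _ _ h h' => rw [add_mul, map_add, map_add, h, h', map_add, smul_add]
      | smul r l _ h => rw [smul_mul_assoc, map_smul, map_smul, h, map_smul, smul_comm]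
    · intro a b h h'
      rw [map_add, map_add, h, h', map_add, smul_add]

/-- in any associative algebra the Dynkin bracketing computes `log (exp x * exp y)` -/
lemma map_bchTerm (hφ : ∀ a b, φ ⁅a, b⁆ = φ a * φ b - φ b * φ a) {n : ℕ} (hn : 1 ≤ n) : φ (bchTerm x y n) = logExpCoeff (φ x) (φ y) n := by
  have hl : ∀ b, FreeAlgebra.ι ℚ b ∈ letters := fun b => Submodule.subset_span ⟨b, rfl⟩
  have h1 := dynkinMap_copr φ x y hφ n (bchWord n)
    (logExpCoeff_mem (hl false) (hl true) n)
  rw [copr_bchWord] at h1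
  have h2 : evalWord φ x y (bchWord n) = logExpCoeff (φ x) (φ y) n := by
    rw [bchWord, map_logExpCoeff]; simp [evalWord]
  rw [← h2, bchTerm, map_smul]
  have h3 : φ (nest x y (bchWord n)) = (n : ℚ) • evalWord φ x y (bchWord n) := by
    rw [← h1]; simp [dynkinMap, nest_one]
  rw [h3, smul_smul, inv_mul_cancel₀ (by positivity), one_smul]

end Dynkin

section Eval

variable {A : Type*} [Ring A] [Algebra ℚ A]

/-- power series whose `n`-th coefficient lies in `S ^ n` -/
def reesAlg (S : Submodule ℚ A) : Subalgebra ℚ (PowerSeries A) where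
  carrier := {f | ∀ n, PowerSeries.coeff n f ∈ S ^ n}
  mul_mem' := by
    intro f g hf hg n
    rw [PowerSeries.coeff_mul]
    refine Submodule.sum_mem _ fun p hp => ?_
    rw [Finset.HasAntidiagonal.mem_antidiagonal] at hp
    rw [← hp, pow_add]
    exact Submodule.mul_mem_mul (hf _) (hg _)
  add_mem' := by
    intro f g hf hg n
    rw [map_add]; exact Submodule.add_mem _ (hf n) (hg n)
  algebraMap_mem' := by
    intro r n
    rw [PowerSeries.algebraMap_apply, PowerSeries.coeff_C]
    split_ifs with h
    · subst h; rw [pow_zero]; exact Submodule.algebraMap_mem r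
    · exact Submodule.zero_mem _

noncomputable def reesEval (S : Submodule ℚ A) (N : ℕ) (hS : S ^ (N + 1) = ⊥) :
    reesAlg S →ₐ[ℚ] A :=
  AlgHom.ofLinearMap
    { toFun := fun f => ∑ n ∈ Finset.range (N + 1), PowerSeries.coeff n f.1
      map_add' := fun f g => by simp [Finset.sum_add_distrib]
      map_smul' := fun r f => by simp [Finset.smul_sum] }
    (by
      simp only [LinearMap.coe_mk, AddHom.coe_mk, OneMemClass.coe_one, PowerSeries.coeff_one]
      simp)
    (by
      intro f g
      have hz : ∀ i j, N < i + j → PowerSeries.coeff i f.1 * PowerSeries.coeff j g.1 = 0 := by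
        intro i j hij
        have h1 : PowerSeries.coeff i f.1 * PowerSeries.coeff j g.1 ∈ S ^ (i + j) := by
          rw [pow_add]; exact Submodule.mul_mem_mul (f.2 _) (g.2 _)
        rw [show i + j = (N + 1) + (i + j - (N + 1)) by omega, pow_add, hS,
          Submodule.bot_mul] at h1
        exact (Submodule.mem_bot ℚ).1 h1
      simp only [LinearMap.coe_mk, AddHom.coe_mk, MulMemClass.coe_mul, PowerSeries.coeff_mul]
      rw [Finset.sum_mul_sum, ← Finset.sum_product', Finset.sum_sigma']
      refine Finset.sum_bij_ne_zero (fun p _ _ => p.2) ?_ ?_ ?_ ?_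
      · rintro ⟨n, i, j⟩ h _
        simp only [Finset.mem_sigma, Finset.mem_range,
          Finset.HasAntidiagonal.mem_antidiagonal, Finset.mem_product] at h ⊢
        omega
      · rintro ⟨n, i, j⟩ h _ ⟨n', i', j'⟩ h' _ e
        simp only [Finset.mem_sigma, Finset.mem_range,
          Finset.HasAntidiagonal.mem_antidiagonal] at h h'
        simp only [Prod.mk.injEq] at e
        obtain ⟨rfl, rfl⟩ := e
        obtain rfl : n = n' := by omega
        rfl
      · rintro ⟨i, j⟩ h hne
        refine ⟨⟨i + j, i, j⟩, ?_, hne, rfl⟩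
        simp only [Finset.mem_sigma, Finset.mem_range,
          Finset.HasAntidiagonal.mem_antidiagonal, and_true]
        by_contra hlt
        exact hne (hz i j (by omega))
      · rintro ⟨n, i, j⟩ _ _
        rfl)

lemma exp_sum_logExpCoeff {S : Submodule ℚ A} {N : ℕ} (hS : S ^ (N + 1) = ⊥) {x y : A}
    (hx : x ∈ S) (hy : y ∈ S) :
    IsNilpotent.exp (∑ n ∈ Finset.Icc 1 N, logExpCoeff x y n) =
      IsNilpotent.exp x * IsNilpotent.exp y := by
  have hz : ∀ z ∈ S, z ^ (N + 1) = 0 := fun z hz => by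
    have := Submodule.pow_mem_pow S hz (N + 1)
    rw [hS] at this
    exact (Submodule.mem_bot ℚ).1 this
  have he : ∀ z ∈ S, expSeries z ∈ reesAlg S := fun z hz n => by
    rw [expSeries, PowerSeries.coeff_mk]
    exact Submodule.smul_mem _ _ (Submodule.pow_mem_pow S hz n)
  have hev : ∀ z (h : z ∈ S), reesEval S N hS ⟨expSeries z, he z h⟩ = IsNilpotent.exp z := by
    intro z h
    rw [IsNilpotent.exp_eq_sum (hz z h)]
    simp [reesEval, expSeries]
  set P : reesAlg S := ⟨expSeries x, he x hx⟩ * ⟨expSeries y, he y hy⟩ - 1 with hP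
  have hP1 : (P : PowerSeries A) = expSeries x * expSeries y - 1 := rfl
  have hPe : reesEval S N hS P = IsNilpotent.exp x * IsNilpotent.exp y - 1 := by
    rw [hP, map_sub, map_mul, hev x hx, hev y hy, map_one]
  have hnil : (reesEval S N hS P) ^ (N + 1) = 0 := by
    rw [← map_pow]
    change ∑ n ∈ Finset.range (N + 1), PowerSeries.coeff n ((P ^ (N + 1) : reesAlg S) : PowerSeries A) = 0
    refine Finset.sum_eq_zero fun n hn => ?_
    rw [Finset.mem_range] at hn
    rw [SubmonoidClass.coe_pow, hP1, coeff_pow_eq_zero (constantCoeff_sub_one x y) hn]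
  have hlog : nlog N (reesEval S N hS P) = ∑ n ∈ Finset.Icc 1 N, logExpCoeff x y n := by
    rw [nlog, Polynomial.aeval_algHom_apply]
    change ∑ n ∈ Finset.range (N + 1),
      PowerSeries.coeff n ((Polynomial.aeval P (logPoly N) : reesAlg S) : PowerSeries A) = _
    have h1 : ((Polynomial.aeval P (logPoly N) : reesAlg S) : PowerSeries A) =
        nlog N (expSeries x * expSeries y - 1) := by
      rw [nlog, ← hP1]
      exact (Polynomial.aeval_algHom_apply (reesAlg S).val P (logPoly N)).symm
    rw [h1]
    have h2 : ∀ n ∈ Finset.range (N + 1), PowerSeries.coeff n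
        (nlog N (expSeries x * expSeries y - 1)) = logExpCoeff x y n := fun n hn =>
      coeff_nlog_exp x y (by rw [Finset.mem_range] at hn; omega)
    rw [Finset.sum_congr rfl h2, Finset.sum_range_succ',
      show Finset.Icc 1 N = Finset.Ico 1 (N + 1) from rfl, Finset.sum_Ico_eq_sum_range]
    have h3 : logExpCoeff x y 0 = 0 := by simp [logExpCoeff]
    rw [h3, add_zero]
    simp [add_comm]
  rw [← hlog, exp_nlog hnil, hPe, add_sub_cancel]

end Eval
end ConDef

namespace ConDef
open CategoryTheory

universe u v

/-! ### Differential graded Lie algebras -/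

/-- A differential graded Lie algebra over `k` (`ℤ`-graded, differential of degree `1`). The
proofs of `i + j = n` in the arguments only serve to avoid casts between equal degrees. -/
structure DGLA (k : Type u) [CommRing k] where
  V : ℤ → Type v
  [addCommGroup : ∀ i, AddCommGroup (V i)]
  [module : ∀ i, Module k (V i)]
  d : ∀ i j : ℤ, i + 1 = j → (V i →ₗ[k] V j)
  bracket : ∀ i j n : ℤ, i + j = n → (V i →ₗ[k] V j →ₗ[k] V n)
  d_d : ∀ (i j l : ℤ) (hij : i + 1 = j) (hjl : j + 1 = l) (x : V i), d j l hjl (d i j hij x) = 0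
  d_bracket : ∀ (i j n i' j' n' : ℤ) (hn : i + j = n) (hi : i + 1 = i') (hj : j + 1 = j')
    (hn' : n + 1 = n') (x : V i) (y : V j),
    d n n' hn' (bracket i j n hn x y) =
      bracket i' j n' (by omega) (d i i' hi x) y +
        i.negOnePow • bracket i j' n' (by omega) x (d j j' hj y)
  skew : ∀ (i j n : ℤ) (hn : i + j = n) (x : V i) (y : V j),
    bracket i j n hn x y = -((i * j).negOnePow • bracket j i n (by omega) y x)
  jacobi : ∀ (i j l ij jl il n : ℤ) (hij : i + j = ij) (hjl : j + l = jl) (hil : i + l = il)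
    (hn : i + jl = n) (x : V i) (y : V j) (z : V l),
    bracket i jl n hn x (bracket j l jl hjl y z) =
      bracket ij l n (by omega) (bracket i j ij hij x y) z +
        (i * j).negOnePow • bracket j il n (by omega) y (bracket i l il hil x z)

attribute [instance] DGLA.addCommGroup DGLA.module

variable {k : Type u} [CommRing k]

namespace DGLA

/-- Morphisms of DGLAs: linear maps of degree `0` compatible with differentials and brackets. -/
@[ext]
structure Hom (g h : DGLA.{u, v} k) where
  f : ∀ i, g.V i →ₗ[k] h.V i
  map_d : ∀ (i j : ℤ) (hij : i + 1 = j) (x : g.V i), f j (g.d i j hij x) = h.d i j hij (f i x)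
  map_bracket : ∀ (i j n : ℤ) (hn : i + j = n) (x : g.V i) (y : g.V j),
    f n (g.bracket i j n hn x y) = h.bracket i j n hn (f i x) (f j y)

instance : Category (DGLA.{u, v} k) where
  Hom := Hom
  id g := ⟨fun _ => LinearMap.id, fun _ _ _ _ => rfl, fun _ _ _ _ _ _ => rfl⟩
  comp φ ψ := ⟨fun i => ψ.f i ∘ₗ φ.f i,
    fun i j hij x => by simp [φ.map_d, ψ.map_d],
    fun i j n hn x y => by simp [φ.map_bracket, ψ.map_bracket]⟩

lemma id_f (g : DGLA.{u, v} k) (i : ℤ) (x : g.V i) : Hom.f (𝟙 g) i x = x := rfl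

lemma comp_f {g h l : DGLA.{u, v} k} (φ : g ⟶ h) (ψ : h ⟶ l) (i : ℤ) (x : g.V i) :
    Hom.f (φ ≫ ψ) i x = Hom.f ψ i (Hom.f φ i x) := rfl

end DGLA

/-! ### Formal power series without constant term -/

/-- `λ E⟦λ⟧`: the formal power series in `λ` with coefficients in `E` and no constant term -/
def lambdaSeries (k : Type u) [CommRing k] (E : Type v) [AddCommGroup E] [Module k E] :
    Submodule k (ℕ → E) where
  carrier := {f | f 0 = 0}
  add_mem' := by intro f g hf hg; simp_all
  zero_mem' := rfl
  smul_mem' := by intro c f hf; simp_all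

lemma sum_antidiagonal_left {E : Type*} [AddCommMonoid E] (f : ℕ → ℕ → ℕ → E) (N : ℕ) :
    ∑ p ∈ Finset.HasAntidiagonal.antidiagonal N, ∑ q ∈ Finset.HasAntidiagonal.antidiagonal p.2, f p.1 q.1 q.2 =
      ∑ p ∈ Finset.HasAntidiagonal.antidiagonal N, ∑ q ∈ Finset.HasAntidiagonal.antidiagonal p.1, f q.1 q.2 p.2 := by
  rw [Finset.sum_sigma', Finset.sum_sigma']
  refine Finset.sum_nbij' (fun p => ⟨(p.1.1 + p.2.1, p.2.2), (p.1.1, p.2.1)⟩)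
    (fun p => ⟨(p.2.1, p.2.2 + p.1.2), (p.2.2, p.1.2)⟩) ?_ ?_ ?_ ?_ ?_
  · rintro ⟨⟨a, b⟩, ⟨c, d⟩⟩ h
    simp only [Finset.mem_sigma, Finset.HasAntidiagonal.mem_antidiagonal, and_true] at h ⊢
    omega
  · rintro ⟨⟨a, b⟩, ⟨c, d⟩⟩ h
    simp only [Finset.mem_sigma, Finset.HasAntidiagonal.mem_antidiagonal, and_true] at h ⊢
    omega
  · rintro ⟨⟨a, b⟩, ⟨c, d⟩⟩ h
    simp only [Finset.mem_sigma, Finset.HasAntidiagonal.mem_antidiagonal] at h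
    obtain ⟨rfl, rfl⟩ := h
    rfl
  · rintro ⟨⟨a, b⟩, ⟨c, d⟩⟩ h
    simp only [Finset.mem_sigma, Finset.HasAntidiagonal.mem_antidiagonal] at h
    obtain ⟨rfl, rfl⟩ := h
    rfl
  · rintro ⟨⟨a, b⟩, ⟨c, d⟩⟩ _
    rfl

lemma sum_antidiagonal_swap {E : Type*} [AddCommMonoid E] (f : ℕ → ℕ → ℕ → E) (N : ℕ) :
    ∑ p ∈ Finset.HasAntidiagonal.antidiagonal N, ∑ q ∈ Finset.HasAntidiagonal.antidiagonal p.2, f p.1 q.1 q.2 =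
      ∑ p ∈ Finset.HasAntidiagonal.antidiagonal N, ∑ q ∈ Finset.HasAntidiagonal.antidiagonal p.2, f q.1 p.1 q.2 := by
  rw [Finset.sum_sigma', Finset.sum_sigma']
  refine Finset.sum_nbij' (fun p => ⟨(p.2.1, p.1.1 + p.2.2), (p.1.1, p.2.2)⟩)
    (fun p => ⟨(p.2.1, p.1.1 + p.2.2), (p.1.1, p.2.2)⟩) ?_ ?_ ?_ ?_ ?_
  · rintro ⟨⟨a, b⟩, ⟨c, d⟩⟩ h
    simp only [Finset.mem_sigma, Finset.HasAntidiagonal.mem_antidiagonal, and_true] at h ⊢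
    omega
  · rintro ⟨⟨a, b⟩, ⟨c, d⟩⟩ h
    simp only [Finset.mem_sigma, Finset.HasAntidiagonal.mem_antidiagonal, and_true] at h ⊢
    omega
  · rintro ⟨⟨a, b⟩, ⟨c, d⟩⟩ h
    simp only [Finset.mem_sigma, Finset.HasAntidiagonal.mem_antidiagonal] at h
    obtain ⟨rfl, rfl⟩ := h
    rfl
  · rintro ⟨⟨a, b⟩, ⟨c, d⟩⟩ h
    simp only [Finset.mem_sigma, Finset.HasAntidiagonal.mem_antidiagonal] at h
    obtain ⟨rfl, rfl⟩ := h
    rfl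
  · rintro ⟨⟨a, b⟩, ⟨c, d⟩⟩ _
    rfl

namespace DGLA

/-- The DGLA `λ g⟦λ⟧`: the structure maps of `g` are extended `λ`-linearly. -/
def formal (g : DGLA.{u, v} k) : DGLA.{u, v} k where
  V i := lambdaSeries k (g.V i)
  d i j h :=
    { toFun := fun x => ⟨fun N => g.d i j h (x.1 N), by
        change g.d i j h (x.1 0) = 0
        rw [show x.1 0 = 0 from x.2, map_zero]⟩
      map_add' := fun x y => by ext N; simp
      map_smul' := fun c x => by ext N; simp }
  bracket i j n h := LinearMap.mk₂ k
    (fun x y => ⟨fun N => ∑ p ∈ Finset.HasAntidiagonal.antidiagonal N, g.bracket i j n h (x.1 p.1) (y.1 p.2), by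
      change ∑ p ∈ Finset.HasAntidiagonal.antidiagonal 0, g.bracket i j n h (x.1 p.1) (y.1 p.2) = 0
      rw [Finset.HasAntidiagonal.antidiagonal_zero, Finset.sum_singleton, show x.1 0 = 0 from x.2]
      simp⟩)
    (fun x x' y => by ext N; simp [Finset.sum_add_distrib])
    (fun c x y => by ext N; simp [Finset.smul_sum])
    (fun x y y' => by ext N; simp [Finset.sum_add_distrib])
    (fun c x y => by ext N; simp [Finset.smul_sum])
  d_d i j l hij hjl x := by ext N; simp [g.d_d]
  d_bracket i j n i' j' n' hn hi hj hn' x y := by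
    ext N
    simp [g.d_bracket i j n i' j' n' hn hi hj hn', Finset.sum_add_distrib, Finset.smul_sum]
  skew i j n hn x y := by
    ext N
    simp only [LinearMap.mk₂_apply]
    change ∑ p ∈ Finset.HasAntidiagonal.antidiagonal N, g.bracket i j n hn (x.1 p.1) (y.1 p.2) =
      -((i * j).negOnePow • ∑ p ∈ Finset.HasAntidiagonal.antidiagonal N,
        g.bracket j i n (by omega) (y.1 p.1) (x.1 p.2))
    rw [← Finset.Nat.sum_antidiagonal_swap, Finset.smul_sum, ← Finset.sum_neg_distrib]
    exact Finset.sum_congr rfl fun p _ => g.skew i j n hn _ _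
  jacobi i j l ij jl il n hij hjl hil hn x y z := by
    ext N
    simp only [LinearMap.mk₂_apply]
    change ∑ p ∈ Finset.HasAntidiagonal.antidiagonal N, g.bracket i jl n hn (x.1 p.1)
        (∑ q ∈ Finset.HasAntidiagonal.antidiagonal p.2, g.bracket j l jl hjl (y.1 q.1) (z.1 q.2)) =
      ∑ p ∈ Finset.HasAntidiagonal.antidiagonal N, g.bracket ij l n (by omega)
        (∑ q ∈ Finset.HasAntidiagonal.antidiagonal p.1, g.bracket i j ij hij (x.1 q.1) (y.1 q.2)) (z.1 p.2) +
      (i * j).negOnePow • ∑ p ∈ Finset.HasAntidiagonal.antidiagonal N, g.bracket j il n (by omega) (y.1 p.1)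
        (∑ q ∈ Finset.HasAntidiagonal.antidiagonal p.2, g.bracket i l il hil (x.1 q.1) (z.1 q.2))
    simp only [map_sum, LinearMap.sum_apply]
    rw [← sum_antidiagonal_left (fun a b c => g.bracket ij l n (by omega)
        (g.bracket i j ij hij (x.1 a) (y.1 b)) (z.1 c)),
      sum_antidiagonal_swap (fun b a c => g.bracket j il n (by omega) (y.1 b)
        (g.bracket i l il hil (x.1 a) (z.1 c)))]
    simp only [Finset.smul_sum, ← Finset.sum_add_distrib]
    exact Finset.sum_congr rfl fun p _ => Finset.sum_congr rfl fun q _ =>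
      g.jacobi i j l ij jl il n hij hjl hil hn _ _ _

/-- the coefficient of `λ ^ N` -/
def coeff {g : DGLA.{u, v} k} {i : ℤ} (N : ℕ) : g.formal.V i →ₗ[k] g.V i :=
  LinearMap.proj N ∘ₗ (lambdaSeries k (g.V i)).subtype

lemma formal_ext {g : DGLA.{u, v} k} {i : ℤ} {x y : g.formal.V i}
    (h : ∀ N, coeff N x = coeff N y) : x = y :=
  Subtype.ext (funext h)

lemma coeff_zero {g : DGLA.{u, v} k} {i : ℤ} (x : g.formal.V i) : coeff 0 x = 0 := x.2

/-- the series with given coefficients -/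
def mkSeries {g : DGLA.{u, v} k} {i : ℤ} (f : ℕ → g.V i) (h : f 0 = 0) : g.formal.V i := ⟨f, h⟩

lemma coeff_mkSeries {g : DGLA.{u, v} k} {i : ℤ} (f : ℕ → g.V i) (h : f 0 = 0) (N : ℕ) :
    coeff N (mkSeries f h) = f N := rfl

lemma coeff_d {g : DGLA.{u, v} k} {i j : ℤ} (h : i + 1 = j) (x : g.formal.V i) (N : ℕ) :
    coeff N (g.formal.d i j h x) = g.d i j h (coeff N x) := rfl

lemma coeff_bracket {g : DGLA.{u, v} k} {i j n : ℤ} (h : i + j = n) (x : g.formal.V i)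
    (y : g.formal.V j) (N : ℕ) : coeff N (g.formal.bracket i j n h x y) =
      ∑ p ∈ Finset.HasAntidiagonal.antidiagonal N, g.bracket i j n h (coeff p.1 x) (coeff p.2 y) := rfl

/-- the `λ`-linear extension of a morphism -/
def formalMap {g h : DGLA.{u, v} k} (φ : g ⟶ h) : g.formal ⟶ h.formal where
  f i :=
    { toFun := fun x => mkSeries (fun N => Hom.f φ i (coeff N x)) (by rw [coeff_zero, map_zero])
      map_add' := fun x y => formal_ext fun N => by simp [coeff_mkSeries]
      map_smul' := fun c x => formal_ext fun N => by simp [coeff_mkSeries] }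
  map_d i j hij x := formal_ext fun N => by
    simp [coeff_mkSeries, coeff_d, φ.map_d]
  map_bracket i j n hn x y := formal_ext fun N => by
    simp [coeff_mkSeries, coeff_bracket, φ.map_bracket]

lemma coeff_formalMap {g h : DGLA.{u, v} k} (φ : g ⟶ h) {i : ℤ} (x : g.formal.V i) (N : ℕ) :
    coeff N (Hom.f (formalMap φ) i x) = Hom.f φ i (coeff N x) := rfl

end DGLA
end ConDef

namespace ConDef

/-! ### The affine representation attached to a representation and a `1`-cocycle -/

section Affine

variable {L V : Type*} [LieRing L] [LieAlgebra ℚ L] [AddCommGroup V] [Module ℚ V]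

/-- the operators `(v, a) ↦ (ρ x v + a c x, 0)` -/
def affine (ρ : L →ₗ[ℚ] Module.End ℚ V) (c : L →ₗ[ℚ] V) : L →ₗ[ℚ] Module.End ℚ (V × ℚ) where
  toFun x :=
    { toFun := fun p => (ρ x p.1 + p.2 • c x, 0)
      map_add' := fun p q => by
        ext
        · simp only [Prod.fst_add, Prod.snd_add, map_add, add_smul]; abel
        · simp
      map_smul' := fun c p => by ext <;> simp [mul_smul] }
  map_add' x y := by
    refine LinearMap.ext fun p => ?_
    ext
    · simp only [map_add, LinearMap.add_apply, LinearMap.coe_mk, AddHom.coe_mk, smul_add,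
        Prod.fst_add]
      abel
    · simp
  map_smul' r x := by
    refine LinearMap.ext fun p => ?_
    ext
    · simp [smul_comm r p.2]
    · simp

/-- a representation of `L` on `V` with a `1`-cocycle, and a filtration of `V` which the elements
of `L` raise -/
structure FilteredCocycle (ρ : L →ₗ[ℚ] Module.End ℚ V) (c : L →ₗ[ℚ] V)
    (F : ℕ → Submodule ℚ V) : Prop where
  rep : ∀ x y, ρ ⁅x, y⁆ = ρ x * ρ y - ρ y * ρ x
  coc : ∀ x y, c ⁅x, y⁆ = ρ x (c y) - ρ y (c x)
  zero : F 0 = ⊤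
  raise : ∀ x n, ∀ v ∈ F n, ρ x v ∈ F (n + 1)

variable {ρ : L →ₗ[ℚ] Module.End ℚ V} {c : L →ₗ[ℚ] V} {F : ℕ → Submodule ℚ V}

lemma affine_lie (h : FilteredCocycle ρ c F) (x y : L) : affine ρ c ⁅x, y⁆ =
    affine ρ c x * affine ρ c y - affine ρ c y * affine ρ c x := by
  refine LinearMap.ext fun p => ?_
  ext
  · simp only [affine, LinearMap.coe_mk, AddHom.coe_mk, h.rep, h.coc, LinearMap.sub_apply,
      Module.End.mul_apply, map_add, map_smul, zero_smul, add_zero, Prod.fst_sub, smul_sub]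
    abel
  · simp [affine]

/-- the filtration of `V × ℚ` -/
def affFil (F : ℕ → Submodule ℚ V) : ℕ → Submodule ℚ (V × ℚ)
  | 0 => ⊤
  | n + 1 => (F n).prod ⊥

lemma affine_raise (h : FilteredCocycle ρ c F) (x : L) (n : ℕ) (p : V × ℚ)
    (hp : p ∈ affFil F n) : affine ρ c x p ∈ affFil F (n + 1) := by
  cases n with
  | zero => exact ⟨by simp [h.zero], by simp [affine]⟩
  | succ n =>
    obtain ⟨h1, h2⟩ := hp
    have h2 : p.2 = 0 := h2
    refine ⟨?_, by simp [affine]⟩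
    simpa [affine, h2] using h.raise x n _ h1

/-- `V × ℚ` modulo the `N`-th filtration step of `V` -/
abbrev AffQuot (F : ℕ → Submodule ℚ V) (N : ℕ) := (V × ℚ) ⧸ affFil F (N + 1)

/-- the operator induced on the quotient -/
def affTrunc (h : FilteredCocycle ρ c F) (hF : Antitone F) (N : ℕ) :
    L →ₗ[ℚ] Module.End ℚ (AffQuot F N) where
  toFun x := (affFil F (N + 1)).mapQ _ (affine ρ c x) (by
    rintro p ⟨h1, h2⟩
    have h2 : p.2 = 0 := h2
    refine ⟨?_, by simp [affine]⟩
    simpa [affine, h2] using hF (Nat.le_succ N) (h.raise x N _ h1))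
  map_add' x y := by
    refine Submodule.linearMap_qext _ (LinearMap.ext fun p => ?_)
    simp
  map_smul' r x := by
    refine Submodule.linearMap_qext _ (LinearMap.ext fun p => ?_)
    simp

variable (h : FilteredCocycle ρ c F) (hF : Antitone F) (N : ℕ)

lemma affTrunc_mk (x : L) (p : V × ℚ) :
    affTrunc h hF N x (Submodule.Quotient.mk p) = Submodule.Quotient.mk (affine ρ c x p) := rfl

lemma affTrunc_lie (x y : L) : affTrunc h hF N ⁅x, y⁆ =
    affTrunc h hF N x * affTrunc h hF N y - affTrunc h hF N y * affTrunc h hF N x := by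
  refine Submodule.linearMap_qext _ (LinearMap.ext fun p => ?_)
  change Submodule.Quotient.mk (affine ρ c ⁅x, y⁆ p) = _
  rw [affine_lie h]
  rfl

/-- operators which raise the filtration -/
def raising (F : ℕ → Submodule ℚ V) (N j : ℕ) : Submodule ℚ (Module.End ℚ (AffQuot F N)) where
  carrier := {T | ∀ n, ∀ p ∈ affFil F n,
    T (Submodule.Quotient.mk p) ∈ (affFil F (n + j)).map (affFil F (N + 1)).mkQ}
  add_mem' := fun hS hT n p hp => Submodule.add_mem _ (hS n p hp) (hT n p hp)
  zero_mem' := fun _ _ _ => Submodule.zero_mem _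
  smul_mem' := fun r _ hT n p hp => Submodule.smul_mem _ r (hT n p hp)

lemma raising_mul (i j : ℕ) : raising F N i * raising F N j ≤ raising F N (i + j) := by
  rw [Submodule.mul_le]
  intro S hS T hT n p hp
  obtain ⟨q, hq, hq'⟩ := hT n p hp
  rw [Module.End.mul_apply, ← hq']
  have := hS (n + j) q hq
  rwa [show n + j + i = n + (i + j) by omega] at this

lemma raising_pow (j : ℕ) : raising F N 1 ^ j ≤ raising F N j := by
  induction j with
  | zero =>
    refine (pow_zero (raising F N 1)).le.trans ?_
    rw [Submodule.one_le]
    exact fun n p hp => ⟨p, hp, rfl⟩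
  | succ j ih =>
    refine (pow_succ (raising F N 1) j).le.trans ?_
    exact (mul_le_mul' ih le_rfl).trans (raising_mul N j 1)

lemma raising_bot : raising F N 1 ^ (N + 1) = ⊥ := by
  rw [eq_bot_iff]
  intro T hT
  rw [Submodule.mem_bot]
  refine Submodule.linearMap_qext _ (LinearMap.ext fun p => ?_)
  obtain ⟨q, hq, hq'⟩ := raising_pow N (N + 1) hT 0 p trivial
  rw [zero_add] at hq
  change T (Submodule.Quotient.mk p) = 0
  rw [← hq']
  exact (Submodule.Quotient.mk_eq_zero _).2 hq

lemma affTrunc_mem (x : L) : affTrunc h hF N x ∈ raising F N 1 :=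
  fun n p hp => ⟨affine ρ c x p, affine_raise h x n p hp, rfl⟩

lemma affTrunc_pow (x : L) : affTrunc h hF N x ^ (N + 1) = 0 := by
  have := Submodule.pow_mem_pow _ (affTrunc_mem h hF N x) (N + 1)
  rw [raising_bot] at this
  exact (Submodule.mem_bot ℚ).1 this

/-- the exponential turns the Baker-Campbell-Hausdorff series into the product -/
lemma exp_affTrunc_bch (x y : L) :
    IsNilpotent.exp (affTrunc h hF N (∑ n ∈ Finset.Icc 1 N, bchTerm x y n)) =
      IsNilpotent.exp (affTrunc h hF N x) * IsNilpotent.exp (affTrunc h hF N y) := by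
  rw [← exp_sum_logExpCoeff (raising_bot N) (affTrunc_mem h hF N x) (affTrunc_mem h hF N y),
    map_sum]
  congr 1
  refine Finset.sum_congr rfl fun n hn => ?_
  exact map_bchTerm _ x y (affTrunc_lie h hF N) (Finset.mem_Icc.1 hn).1

lemma affine_pow (x : L) (j : ℕ) (v : V) (a : ℚ) : (affine ρ c x ^ (j + 1)) (v, a) =
    ((ρ x ^ (j + 1)) v + a • (ρ x ^ j) (c x), 0) := by
  induction j with
  | zero => simp [affine]
  | succ j ih =>
    rw [pow_succ', Module.End.mul_apply, ih]
    simp [affine, pow_succ' (ρ x)]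

lemma affTrunc_pow_mk (x : L) (j : ℕ) (p : V × ℚ) :
    (affTrunc h hF N x ^ j) (Submodule.Quotient.mk p) =
      Submodule.Quotient.mk ((affine ρ c x ^ j) p) := by
  induction j with
  | zero => rfl
  | succ j ih => rw [pow_succ', pow_succ', Module.End.mul_apply, ih, Module.End.mul_apply,
      affTrunc_mk]

lemma rho_pow_mem (h : FilteredCocycle ρ c F) (x : L) (j n : ℕ) (v : V) (hv : v ∈ F n) :
    (ρ x ^ j) v ∈ F (n + j) := by
  induction j with
  | zero => simpa using hv
  | succ j ih => rw [pow_succ', Module.End.mul_apply]; exact h.raise x _ _ ih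

/-- the affine exponential, up to the term of order `N` -/
noncomputable def expAff (ρ : L →ₗ[ℚ] Module.End ℚ V) (c : L →ₗ[ℚ] V) (x : L) (v : V) (a : ℚ)
    (N : ℕ) : V :=
  ∑ j ∈ Finset.range (N + 1), ((j.factorial : ℚ)⁻¹) • (ρ x ^ j) v +
    a • ∑ j ∈ Finset.range (N + 1), (((j + 1).factorial : ℚ)⁻¹) • (ρ x ^ j) (c x)

lemma expAff_sub_mem (h : FilteredCocycle ρ c F) (hF : Antitone F) (x : L) (v : V) (a : ℚ) {N M : ℕ} (hNM : N ≤ M) :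
    expAff ρ c x v a M - expAff ρ c x v a N ∈ F (N + 1) := by
  obtain ⟨d, rfl⟩ := Nat.exists_eq_add_of_le hNM
  clear hNM
  induction d with
  | zero => simp
  | succ d ih =>
    have : expAff ρ c x v a (N + (d + 1)) - expAff ρ c x v a N =
        (expAff ρ c x v a (N + d) - expAff ρ c x v a N) +
        ((((N + d + 1).factorial : ℚ)⁻¹) • (ρ x ^ (N + d + 1)) v +
          a • (((N + d + 1 + 1).factorial : ℚ)⁻¹) • (ρ x ^ (N + d + 1)) (c x)) := by
      have e : expAff ρ c x v a (N + (d + 1)) = expAff ρ c x v a (N + d) +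
          ((((N + d + 1).factorial : ℚ)⁻¹) • (ρ x ^ (N + d + 1)) v +
          a • (((N + d + 1 + 1).factorial : ℚ)⁻¹) • (ρ x ^ (N + d + 1)) (c x)) := by
        rw [expAff, ← add_assoc N d 1, Finset.sum_range_succ, Finset.sum_range_succ _ (N + d + 1),
          expAff, smul_add]
        abel
      rw [e]
      abel
    rw [this]
    have hm : ∀ w, (ρ x ^ (N + d + 1)) w ∈ F (N + 1) := fun w => by
      refine hF (show N + 1 ≤ 0 + (N + d + 1) by omega) (rho_pow_mem h x _ 0 w ?_)
      simp [h.zero]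
    exact Submodule.add_mem _ ih (Submodule.add_mem _ (Submodule.smul_mem _ _ (hm _))
      (Submodule.smul_mem _ _ (Submodule.smul_mem _ _ (hm _))))

lemma exp_affTrunc_mk (x : L) (v : V) (a : ℚ) :
    IsNilpotent.exp (affTrunc h hF N x) (Submodule.Quotient.mk (v, a)) =
      Submodule.Quotient.mk (expAff ρ c x v a N, a) := by
  have h1 : affTrunc h hF N x ^ (N + 1 + 1) = 0 := by rw [pow_succ, affTrunc_pow, zero_mul]
  rw [IsNilpotent.exp_eq_sum h1, LinearMap.sum_apply]
  have h2 : ∀ j ∈ Finset.range (N + 1 + 1), (((j.factorial : ℚ)⁻¹) • affTrunc h hF N x ^ j)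
      (Submodule.Quotient.mk (v, a)) = (affFil F (N + 1)).mkQ
        (((j.factorial : ℚ)⁻¹) • (affine ρ c x ^ j) (v, a)) := by
    intro j _
    rw [LinearMap.smul_apply, affTrunc_pow_mk, map_smul]
    rfl
  rw [Finset.sum_congr rfl h2, ← map_sum]
  refine (Submodule.Quotient.eq _).2 ?_
  rw [Finset.sum_range_succ']
  simp only [affine_pow]
  have h3 : ∑ j ∈ Finset.range (N + 1), (((j + 1).factorial : ℚ)⁻¹) •
      (((ρ x ^ (j + 1)) v + a • (ρ x ^ j) (c x), (0 : ℚ)) : V × ℚ) +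
      (((Nat.factorial 0 : ℕ) : ℚ)⁻¹) • (affine ρ c x ^ 0) (v, a) =
      (expAff ρ c x v a N + (((N + 1).factorial : ℚ)⁻¹) • (ρ x ^ (N + 1)) v, a) := by
    ext
    · have e1 := Finset.sum_range_succ' (fun j => ((j.factorial : ℚ)⁻¹) • (ρ x ^ j) v) (N + 1)
      rw [Finset.sum_range_succ] at e1
      simp only [Prod.fst_add, Prod.fst_sum, Prod.smul_fst, smul_add, Finset.sum_add_distrib,
        smul_comm _ a, ← Finset.smul_sum, expAff, pow_zero, Module.End.one_apply] at e1 ⊢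
      rw [add_right_comm, ← e1]
      abel
    · simp [Prod.snd_sum]
  rw [h3]
  refine ⟨?_, by simp⟩
  have h4 : (ρ x ^ (N + 1)) v ∈ F N := by
    refine hF (show N ≤ 0 + (N + 1) by omega) (rho_pow_mem h x _ 0 v ?_)
    rw [h.zero]; trivial
  simpa using Submodule.smul_mem _ _ h4

end Affine
end ConDef

namespace ConDef
open CategoryTheory

universe u v

variable {k : Type u} [CommRing k] [Algebra ℚ k]

namespace DGLA

instance (g : DGLA.{u, v} k) (i : ℤ) : Module ℚ (g.V i) := Module.compHom _ (algebraMap ℚ k)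

instance (g : DGLA.{u, v} k) (i : ℤ) : IsScalarTower ℚ k (g.V i) :=
  IsScalarTower.of_algebraMap_smul fun _ _ => rfl

/-- the Lie algebra of elements of degree `0` -/
instance (g : DGLA.{u, v} k) : LieRing (g.V 0) where
  bracket x y := g.bracket 0 0 0 rfl x y
  add_lie x y z := by simp
  lie_add x y z := by simp
  lie_self x := by
    have h := g.skew 0 0 0 rfl x x
    simp only [mul_zero, Int.negOnePow_zero, one_smul] at h
    have h2 : (2 : ℚ) • g.bracket 0 0 0 rfl x x = 0 := by
      rw [two_smul]; nth_rewrite 1 [h]; simp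
    exact (smul_eq_zero.1 h2).resolve_left (by norm_num)
  leibniz_lie x y z := by
    have h := g.jacobi 0 0 0 0 0 0 0 rfl rfl rfl rfl x y z
    simpa using h

lemma lie_def (g : DGLA.{u, v} k) (x y : g.V 0) : ⁅x, y⁆ = g.bracket 0 0 0 rfl x y := rfl

instance (g : DGLA.{u, v} k) : LieAlgebra ℚ (g.V 0) where
  lie_smul r x y := by
    rw [lie_def, lie_def, map_rat_smul]

/-- the adjoint action of degree `0` elements on the component of degree `i` -/
def ad (g : DGLA.{u, v} k) (i : ℤ) : g.V 0 →ₗ[ℚ] Module.End ℚ (g.V i) where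
  toFun x := (g.bracket 0 i i (zero_add i) x).restrictScalars ℚ
  map_add' x y := by ext z; simp
  map_smul' r x := by
    ext z
    rw [map_rat_smul]
    simp

lemma ad_apply (g : DGLA.{u, v} k) {i : ℤ} (x : g.V 0) (y : g.V i) :
    g.ad i x y = g.bracket 0 i i (zero_add i) x y := rfl

lemma ad_lie (g : DGLA.{u, v} k) (i : ℤ) (x y : g.V 0) :
    g.ad i ⁅x, y⁆ = g.ad i x * g.ad i y - g.ad i y * g.ad i x := by
  ext z
  have h := g.jacobi 0 0 i 0 i i i rfl (zero_add i) (zero_add i) (zero_add i) x y z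
  rw [zero_mul, Int.negOnePow_zero, one_smul] at h
  simp only [LinearMap.sub_apply, Module.End.mul_apply, ad_apply, lie_def]
  rw [h]; abel

/-- the `λ`-adic filtration -/
def adic (g : DGLA.{u, v} k) (i : ℤ) (n : ℕ) : Submodule ℚ (g.formal.V i) where
  carrier := {x | ∀ m ≤ n, coeff m x = 0}
  add_mem' := fun hx hy m hm => by rw [map_add, hx m hm, hy m hm, add_zero]
  zero_mem' := fun m _ => map_zero _
  smul_mem' := fun r x hx m hm => by rw [map_rat_smul, hx m hm, smul_zero]

lemma adic_antitone (g : DGLA.{u, v} k) (i : ℤ) : Antitone (g.adic i) :=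
  fun _ _ h _ hx m hm => hx m (hm.trans h)

lemma bracket_adic (g : DGLA.{u, v} k) {i j l : ℤ} (h : i + j = l) {a b : ℕ} {x : g.formal.V i}
    {y : g.formal.V j} (hx : x ∈ g.adic i a) (hy : y ∈ g.adic j b) :
    g.formal.bracket i j l h x y ∈ g.adic l (a + b + 1) := by
  intro m hm
  rw [coeff_bracket]
  refine Finset.sum_eq_zero fun p hp => ?_
  rw [Finset.HasAntidiagonal.mem_antidiagonal] at hp
  by_cases h1 : p.1 ≤ a
  · rw [hx _ h1, map_zero, LinearMap.zero_apply]
  · rw [hy _ (by omega), map_zero]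

lemma mem_adic_zero (g : DGLA.{u, v} k) {i : ℤ} (x : g.formal.V i) : x ∈ g.adic i 0 := by
  intro m hm
  obtain rfl : m = 0 := by omega
  exact coeff_zero x

lemma filteredCocycle (g : DGLA.{u, v} k) (i : ℤ) (c : g.formal.V 0 →ₗ[ℚ] g.formal.V i)
    (hc : ∀ x y, c ⁅x, y⁆ = g.formal.ad i x (c y) - g.formal.ad i y (c x)) :
    FilteredCocycle (g.formal.ad i) c (g.adic i) where
  rep := g.formal.ad_lie i
  coc := hc
  zero := eq_top_iff.2 fun x _ => g.mem_adic_zero x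
  raise x n v hv := by
    have := g.bracket_adic (zero_add i) (g.mem_adic_zero x) hv
    rwa [zero_add] at this

/-- the Euler derivation `λ d/dλ` -/
def euler (g : DGLA.{u, v} k) : g.formal.V 0 →ₗ[ℚ] g.formal.V 0 where
  toFun x := mkSeries (fun N => (N : ℚ) • coeff N x) (by simp)
  map_add' x y := formal_ext fun N => by simp [coeff_mkSeries]
  map_smul' r x := formal_ext fun N => by
    rw [coeff_mkSeries, map_rat_smul, map_rat_smul, coeff_mkSeries, smul_comm]
    rfl

lemma coeff_euler (g : DGLA.{u, v} k) (x : g.formal.V 0) (N : ℕ) :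
    coeff N (g.euler x) = (N : ℚ) • coeff N x := rfl

lemma euler_lie (g : DGLA.{u, v} k) (x y : g.formal.V 0) :
    g.euler ⁅x, y⁆ = g.formal.ad 0 x (g.euler y) - g.formal.ad 0 y (g.euler x) := by
  rw [ad_apply, ad_apply, ← lie_def, ← lie_def, ← lie_skew y, sub_neg_eq_add]
  refine formal_ext fun N => ?_
  rw [coeff_euler, map_add]
  simp only [lie_def, coeff_bracket, coeff_euler]
  rw [Finset.smul_sum, ← Finset.sum_add_distrib]
  refine Finset.sum_congr rfl fun p hp => ?_
  rw [Finset.HasAntidiagonal.mem_antidiagonal] at hp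
  rw [← hp]
  rw [map_rat_smul, map_rat_smul, LinearMap.smul_apply, ← add_smul]
  push_cast
  rw [add_comm]

/-- the component of degree `n` of the Baker-Campbell-Hausdorff series lies in `λⁿ g⟦λ⟧` -/
lemma bchTerm_adic (g : DGLA.{u, v} k) (x y : g.formal.V 0) (n : ℕ) :
    bchTerm x y (n + 1) ∈ g.adic 0 n := by
  refine Submodule.smul_mem _ _ ?_
  have key : ∀ n, ∀ a ∈ letters ^ (n + 1), nest x y a ∈ g.adic 0 n := by
    intro n
    induction n with
    | zero => intro a _; exact g.mem_adic_zero _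
    | succ n ih =>
      intro a ha
      rw [pow_succ'] at ha
      refine Submodule.mul_induction_on ha ?_ fun a b h h' => by
        rw [map_add]; exact Submodule.add_mem _ h h'
      intro l hl c hc
      rw [letters] at hl
      induction hl using Submodule.span_induction with
      | mem l hl =>
        obtain ⟨b, rfl⟩ := hl
        have h0 : counit c = 0 := by
          rw [pow_succ'] at hc
          refine Submodule.mul_induction_on hc ?_ fun a b h h' => by rw [map_add, h, h', add_zero]
          intro l hl d _
          rw [letters] at hl
          induction hl using Submodule.span_induction with
          | mem l hl =>
            obtain ⟨b, rfl⟩ := hl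
            simp [counit]
          | zero => simp
          | add l l' _ _ h h' => rw [add_mul, map_add, h, h', add_zero]
          | smul r l _ h => rw [smul_mul_assoc, map_smul, h, smul_zero]
        rw [nest_mul, h0, zero_smul, add_zero]
        have := g.bracket_adic (zero_add 0) (g.mem_adic_zero (cond b y x)) (ih c hc)
        rwa [zero_add] at this
      | zero => rw [zero_mul, map_zero]; exact Submodule.zero_mem _
      | add l l' _ _ h h' => rw [add_mul, map_add]; exact Submodule.add_mem _ h h'
      | smul r l _ h => rw [smul_mul_assoc, map_smul]; exact Submodule.smul_mem _ _ h
  have hl : ∀ b, FreeAlgebra.ι ℚ b ∈ letters := fun b => Submodule.subset_span ⟨b, rfl⟩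
  exact key n _ (logExpCoeff_mem (hl false) (hl true) (n + 1))

/-- The Baker-Campbell-Hausdorff series `x + y + ⁅x, y⁆ / 2 + ⋯` on `λ g⁰⟦λ⟧`: the sum over all
`n ≥ 1` of its components of degree `n`, only finitely many of which contribute to each power
of `λ`. -/
noncomputable def bch {g : DGLA.{u, v} k} (x y : g.formal.V 0) : g.formal.V 0 :=
  mkSeries (fun N => ∑ n ∈ Finset.Icc 1 N, coeff N (bchTerm x y n)) (by simp)

lemma bch_sub_mem {g : DGLA.{u, v} k} (x y : g.formal.V 0) (N : ℕ) :
    bch x y - ∑ n ∈ Finset.Icc 1 N, bchTerm x y n ∈ g.adic 0 N := by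
  intro m hm
  rw [map_sub, bch, coeff_mkSeries, map_sum, sub_eq_zero]
  refine Finset.sum_subset (Finset.Icc_subset_Icc_right hm) fun n hn hn' => ?_
  rw [Finset.mem_Icc] at hn hn'
  obtain ⟨n, rfl⟩ := Nat.exists_eq_add_of_le' hn.1
  exact g.bchTerm_adic x y n m (by omega)

section Exp

variable {g : DGLA.{u, v} k} {i : ℤ} {c : g.formal.V 0 →ₗ[ℚ] g.formal.V i}
  (hc : ∀ x y, c ⁅x, y⁆ = g.formal.ad i x (c y) - g.formal.ad i y (c x))
  (hcF : ∀ N, ∀ x ∈ g.adic 0 N, c x ∈ g.adic i N)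

/-- the truncated affine representation attached to a cocycle -/
noncomputable abbrev trunc (N : ℕ) :
    g.formal.V 0 →ₗ[ℚ] Module.End ℚ (AffQuot (g.adic i) N) :=
  affTrunc (g.filteredCocycle i c hc) (g.adic_antitone i) N

lemma trunc_eq_zero (hcF : ∀ N, ∀ x ∈ g.adic 0 N, c x ∈ g.adic i N) {N : ℕ} {x : g.formal.V 0}
    (hx : x ∈ g.adic 0 N) : trunc hc N x = 0 := by
  refine Submodule.linearMap_qext _ (LinearMap.ext fun p => ?_)
  refine (Submodule.Quotient.mk_eq_zero _).2 ⟨?_, by simp [affine]⟩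
  refine Submodule.add_mem _ ?_ (Submodule.smul_mem _ _ (hcF N x hx))
  have := g.bracket_adic (zero_add i) hx (g.mem_adic_zero p.1)
  exact g.adic_antitone i (by omega) this

lemma exp_trunc_bch (hcF : ∀ N, ∀ x ∈ g.adic 0 N, c x ∈ g.adic i N) (N : ℕ) (x y : g.formal.V 0) :
    IsNilpotent.exp (trunc hc N (bch x y)) =
      IsNilpotent.exp (trunc hc N x) * IsNilpotent.exp (trunc hc N y) := by
  rw [← exp_affTrunc_bch]
  have := trunc_eq_zero hc hcF (bch_sub_mem x y N)
  rw [map_sub, sub_eq_zero] at this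
  rw [this]

end Exp

lemma euler_adic (g : DGLA.{u, v} k) (N : ℕ) (x : g.formal.V 0) (hx : x ∈ g.adic 0 N) :
    g.euler x ∈ g.adic 0 N := fun m hm => by rw [coeff_euler, hx m hm, smul_zero]

/-- the affine representation attached to the Euler derivation is faithful -/
lemma eq_of_exp_eq {g : DGLA.{u, v} k} {x y : g.formal.V 0}
    (h : ∀ N, IsNilpotent.exp (trunc g.euler_lie N x) = IsNilpotent.exp (trunc g.euler_lie N y)) :
    x = y := by
  refine formal_ext fun N => ?_
  have h1 : trunc g.euler_lie N x = trunc g.euler_lie N y := by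
    have hp := fun z => affTrunc_pow (g.filteredCocycle 0 g.euler g.euler_lie)
      (g.adic_antitone 0) N z
    rw [← nlog_exp (hp x), ← nlog_exp (hp y), h N]
  have h2 := congrArg (fun T => T (Submodule.Quotient.mk ((0 : g.formal.V 0), (1 : ℚ)))) h1
  simp only [trunc, affTrunc_mk] at h2
  have h3 := ((Submodule.Quotient.eq _).1 h2).1 N le_rfl
  simp only [affine, LinearMap.coe_mk, AddHom.coe_mk, map_zero, one_smul, zero_add,
    Prod.fst_sub, map_sub, coeff_euler, ← smul_sub] at h3
  rcases N with _ | N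
  · rw [coeff_zero, coeff_zero]
  · exact sub_eq_zero.1 ((smul_eq_zero.1 h3).resolve_left (by positivity))

/-- The gauge group: `λ g⁰⟦λ⟧` with the Baker-Campbell-Hausdorff multiplication. -/
@[ext]
structure Gauge (g : DGLA.{u, v} k) where
  val : g.formal.V 0

noncomputable instance (g : DGLA.{u, v} k) : Group (Gauge g) where
  mul a b := ⟨bch a.val b.val⟩
  one := ⟨0⟩
  inv a := ⟨-a.val⟩
  mul_assoc a b c := Gauge.ext <| eq_of_exp_eq fun N => by
    change IsNilpotent.exp (trunc g.euler_lie N (bch (bch a.val b.val) c.val)) =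
      IsNilpotent.exp (trunc g.euler_lie N (bch a.val (bch b.val c.val)))
    simp only [exp_trunc_bch g.euler_lie g.euler_adic, mul_assoc]
  one_mul a := Gauge.ext <| eq_of_exp_eq fun N => by
    change IsNilpotent.exp (trunc g.euler_lie N (bch 0 a.val)) = _
    rw [exp_trunc_bch g.euler_lie g.euler_adic, map_zero, IsNilpotent.exp_zero, one_mul]
  mul_one a := Gauge.ext <| eq_of_exp_eq fun N => by
    change IsNilpotent.exp (trunc g.euler_lie N (bch a.val 0)) = _
    rw [exp_trunc_bch g.euler_lie g.euler_adic, map_zero, IsNilpotent.exp_zero, mul_one]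
  inv_mul_cancel a := Gauge.ext <| eq_of_exp_eq fun N => by
    change IsNilpotent.exp (trunc g.euler_lie N (bch (-a.val) a.val)) =
      IsNilpotent.exp (trunc g.euler_lie N 0)
    rw [exp_trunc_bch g.euler_lie g.euler_adic, map_neg, map_zero, IsNilpotent.exp_zero]
    exact IsNilpotent.exp_neg_mul_exp_self ⟨N + 1, affTrunc_pow _ _ N _⟩

lemma Gauge.mul_val {g : DGLA.{u, v} k} (a b : Gauge g) : (a * b).val = bch a.val b.val := rfl
lemma Gauge.one_val {g : DGLA.{u, v} k} : (1 : Gauge g).val = 0 := rfl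
lemma Gauge.inv_val {g : DGLA.{u, v} k} (a : Gauge g) : (a⁻¹).val = -a.val := rfl

end DGLA
end ConDef

namespace ConDef
open CategoryTheory TensorProduct

universe u v

variable {k : Type u} [CommRing k] [Algebra ℚ k]

lemma exp_bilin {P Q : Type*} [AddCommGroup P] [Module ℚ P] [AddCommGroup Q] [Module ℚ Q]
    (B : P →ₗ[ℚ] P →ₗ[ℚ] Q) {T : Module.End ℚ P} {S : Module.End ℚ Q} (hT : IsNilpotent T)
    (hS : IsNilpotent S) (h : ∀ m m', S (B m m') = B (T m) m' + B m (T m')) (m m' : P) :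
    IsNilpotent.exp S (B m m') = B (IsNilpotent.exp T m) (IsNilpotent.exp T m') := by
  let TL : Module.End ℚ (P ⊗[ℚ] P) := T.lTensor P
  let TR : Module.End ℚ (P ⊗[ℚ] P) := T.rTensor P
  have hL : IsNilpotent TL := hT.map (Module.End.lTensorAlgHom ℚ P P)
  have hR : IsNilpotent TR := hT.map (Module.End.rTensorAlgHom ℚ P P)
  have hc : Commute TR TL := TensorProduct.ext' fun p q => by simp [TL, TR]
  have h1 : S ∘ₗ TensorProduct.lift B = TensorProduct.lift B ∘ₗ (TR + TL) :=
    TensorProduct.ext' fun p q => by simp [TL, TR, h]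
  have h2 := Module.End.commute_exp_left_of_commute (hc.isNilpotent_add hR hL) hS h1
  have hL' : IsNilpotent.exp TL = (IsNilpotent.exp T).lTensor P :=
    (hT.map_exp (Module.End.lTensorAlgHom ℚ P P)).symm
  have hR' : IsNilpotent.exp TR = (IsNilpotent.exp T).rTensor P :=
    (hT.map_exp (Module.End.rTensorAlgHom ℚ P P)).symm
  have h3 := congrArg (fun f => f (m ⊗ₜ m')) h2
  rw [IsNilpotent.exp_add_of_commute hc hR hL, hL', hR'] at h3
  simpa using h3

namespace DGLA

/-- The set of Maurer-Cartan elements: `ξ` of degree `1` with `d ξ + ⁅ξ, ξ⁆ / 2 = 0`. -/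
def MC (g : DGLA.{u, v} k) : Type v :=
  {ξ : g.V 1 // g.d 1 2 rfl ξ + (2⁻¹ : ℚ) • g.bracket 1 1 2 rfl ξ ξ = 0}

/-- the `1`-cocycle `x ↦ - d x` of degree `0` elements -/
def negD (g : DGLA.{u, v} k) : g.V 0 →ₗ[ℚ] g.V 1 :=
  -((g.d 0 1 rfl).restrictScalars ℚ)

lemma negD_apply (g : DGLA.{u, v} k) (x : g.V 0) : g.negD x = - g.d 0 1 rfl x := rfl

lemma negD_lie (g : DGLA.{u, v} k) (x y : g.V 0) :
    g.negD ⁅x, y⁆ = g.ad 1 x (g.negD y) - g.ad 1 y (g.negD x) := by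
  have h1 := g.d_bracket 0 0 0 1 1 1 rfl rfl rfl rfl x y
  have h2 := g.skew 1 0 1 rfl (g.d 0 1 rfl x) y
  rw [Int.negOnePow_zero, one_smul] at h1
  rw [mul_zero, Int.negOnePow_zero, one_smul] at h2
  rw [negD_apply, lie_def, h1, h2, ad_apply, ad_apply, negD_apply, negD_apply, map_neg, map_neg]
  abel

lemma negD_adic (g : DGLA.{u, v} k) (N : ℕ) (x : g.formal.V 0) (hx : x ∈ g.adic 0 N) :
    g.formal.negD x ∈ g.adic 1 N := fun m hm => by
  rw [negD_apply, map_neg, coeff_d, hx m hm, map_zero, neg_zero]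

/-- The gauge action `a ▷ ξ = exp (ad a) ξ - ∑ j, (ad a) ^ j / (j + 1)! (d a)`, where only the terms
with `j ≤ N` contribute to the coefficient of `λ ^ N`. -/
noncomputable def Gauge.act {g : DGLA.{u, v} k} (a : Gauge g) (ξ : g.formal.V 1) :
    g.formal.V 1 :=
  mkSeries (fun N => coeff N
    (∑ j ∈ Finset.range (N + 1), ((j.factorial : ℚ)⁻¹) • (g.formal.ad 1 a.val ^ j) ξ -
      ∑ j ∈ Finset.range (N + 1), (((j + 1).factorial : ℚ)⁻¹) •
        (g.formal.ad 1 a.val ^ j) (g.formal.d 0 1 rfl a.val))) (coeff_zero _)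

lemma coeff_act {g : DGLA.{u, v} k} (a : Gauge g) (ξ : g.formal.V 1) (N : ℕ) :
    coeff N (a.act ξ) = coeff N
      (expAff (g.formal.ad 1) g.formal.negD a.val ξ 1 N) := by
  rw [Gauge.act, coeff_mkSeries, expAff, one_smul, sub_eq_add_neg, ← Finset.sum_neg_distrib]
  simp only [negD_apply, map_neg, smul_neg]

lemma act_sub_mem {g : DGLA.{u, v} k} (a : Gauge g) (ξ : g.formal.V 1) (N : ℕ) :
    a.act ξ - expAff (g.formal.ad 1) g.formal.negD a.val ξ 1 N ∈ g.adic 1 N := by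
  intro m hm
  have h := expAff_sub_mem (g.filteredCocycle 1 _ g.formal.negD_lie) (g.adic_antitone 1) a.val ξ 1
    hm m (Nat.le_succ m)
  rw [map_sub, sub_eq_zero] at h
  rw [map_sub, coeff_act, h, sub_self]

lemma exp_trunc_mk {g : DGLA.{u, v} k} (a : Gauge g) (ξ : g.formal.V 1) (N : ℕ) :
    IsNilpotent.exp (trunc g.formal.negD_lie N a.val) (Submodule.Quotient.mk (ξ, 1)) =
      Submodule.Quotient.mk (a.act ξ, 1) := by
  rw [exp_affTrunc_mk]
  have hm : ((a.act ξ, (1 : ℚ)) -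
      (expAff (g.formal.ad 1) g.formal.negD a.val ξ 1 N, (1 : ℚ)) : g.formal.V 1 × ℚ) ∈
      affFil (g.adic 1) (N + 1) := ⟨act_sub_mem a ξ N, by simp⟩
  exact ((Submodule.Quotient.eq _).2 hm).symm

lemma eq_of_mk_eq {g : DGLA.{u, v} k} {ξ η : g.formal.V 1}
    (h : ∀ N, (Submodule.Quotient.mk (ξ, 1) : AffQuot (g.adic 1) N) =
      Submodule.Quotient.mk (η, 1)) : ξ = η := by
  refine formal_ext fun N => ?_
  have := ((Submodule.Quotient.eq _).1 (h N)).1 N le_rfl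
  rwa [Prod.fst_sub, map_sub, sub_eq_zero] at this

lemma one_act {g : DGLA.{u, v} k} (ξ : g.formal.V 1) : (1 : Gauge g).act ξ = ξ :=
  eq_of_mk_eq fun N => by
    rw [← exp_trunc_mk, Gauge.one_val, map_zero, IsNilpotent.exp_zero, Module.End.one_apply]

lemma mul_act {g : DGLA.{u, v} k} (a b : Gauge g) (ξ : g.formal.V 1) :
    (a * b).act ξ = a.act (b.act ξ) :=
  eq_of_mk_eq fun N => by
    rw [← exp_trunc_mk, Gauge.mul_val, exp_trunc_bch _ g.negD_adic, Module.End.mul_apply,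
      exp_trunc_mk, exp_trunc_mk]

/-! The gauge action preserves Maurer-Cartan elements -/

section Curvature

variable (g : DGLA.{u, v} k)

/-- the symmetric bilinear map with `((ξ, 1), (ξ, 1)) ↦ ⁅ξ, ξ⁆ + 2 d ξ` -/
def curv : (g.formal.V 1 × ℚ) →ₗ[ℚ] (g.formal.V 1 × ℚ) →ₗ[ℚ] (g.formal.V 2 × ℚ) :=
  LinearMap.mk₂ ℚ (fun p q => (g.formal.bracket 1 1 2 rfl p.1 q.1 +
      p.2 • g.formal.d 1 2 rfl q.1 + q.2 • g.formal.d 1 2 rfl p.1, 0))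
    (fun p p' q => by
      ext1
      · simp only [Prod.fst_add, Prod.snd_add, map_add, LinearMap.add_apply, add_smul, smul_add]
        abel
      · simp)
    (fun r p q => by
      ext1
      · simp only [Prod.smul_fst, Prod.smul_snd, map_rat_smul, smul_add, smul_assoc,
          smul_comm r q.2]
        rw [← LinearMap.restrictScalars_apply ℚ]
        simp
      · simp)
    (fun p q q' => by
      ext1
      · simp only [Prod.fst_add, Prod.snd_add, map_add, LinearMap.add_apply, add_smul, smul_add]
        abel
      · simp)
    (fun r p q => by
      ext1
      · simp only [Prod.smul_fst, Prod.smul_snd, map_rat_smul, smul_add, smul_assoc,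
          smul_comm r p.2]
      · simp)

lemma curv_mem (N : ℕ) (p q : g.formal.V 1 × ℚ) (hp : p ∈ affFil (g.adic 1) (N + 1)) :
    g.curv p q ∈ affFil (g.adic 2) (N + 1) ∧ g.curv q p ∈ affFil (g.adic 2) (N + 1) := by
  obtain ⟨h1, h2⟩ := hp
  have h2 : p.2 = 0 := h2
  have hb := g.adic_antitone 2 (by omega) (g.bracket_adic (rfl : (1 : ℤ) + 1 = 2) h1
    (g.mem_adic_zero q.1)) (a := N)
  have hb' := g.adic_antitone 2 (by omega) (g.bracket_adic (rfl : (1 : ℤ) + 1 = 2)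
    (g.mem_adic_zero q.1) h1) (a := N)
  have hd : g.formal.d 1 2 rfl p.1 ∈ g.adic 2 N := fun m hm => by
    rw [coeff_d, h1 m hm, map_zero]
  refine ⟨⟨?_, by simp [curv]⟩, ⟨?_, by simp [curv]⟩⟩
  · simp only [curv, LinearMap.mk₂_apply, h2, zero_smul, add_zero]
    exact Submodule.add_mem _ hb (Submodule.smul_mem _ _ hd)
  · simp only [curv, LinearMap.mk₂_apply, h2, zero_smul, add_zero]
    exact Submodule.add_mem _ hb' (Submodule.smul_mem _ _ hd)

lemma curv_affine (x : g.formal.V 0) (p q : g.formal.V 1 × ℚ) :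
    g.curv (affine (g.formal.ad 1) g.formal.negD x p) q +
      g.curv p (affine (g.formal.ad 1) g.formal.negD x q) =
      affine (g.formal.ad 2) 0 x (g.curv p q) := by
  have hdd := g.formal.d_d 0 1 2 rfl rfl x
  have hd : ∀ v : g.formal.V 1, g.formal.d 1 2 rfl (g.formal.bracket 0 1 1 rfl x v) =
      g.formal.bracket 1 1 2 rfl (g.formal.d 0 1 rfl x) v +
        g.formal.bracket 0 2 2 rfl x (g.formal.d 1 2 rfl v) := fun v => by
    have := g.formal.d_bracket 0 1 1 1 2 2 rfl rfl rfl rfl x v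
    rwa [Int.negOnePow_zero, one_smul] at this
  have hj := g.formal.jacobi 0 1 1 1 2 1 2 rfl rfl rfl rfl x p.1 q.1
  rw [zero_mul, Int.negOnePow_zero, one_smul] at hj
  have hs := g.formal.skew 1 1 2 rfl p.1 (g.formal.d 0 1 rfl x)
  rw [one_mul, Int.negOnePow_one, Units.neg_smul, one_smul, neg_neg] at hs
  ext1
  · simp only [curv, affine, LinearMap.mk₂_apply, LinearMap.coe_mk, AddHom.coe_mk, Prod.fst_add,
      map_add, map_rat_smul, LinearMap.add_apply, negD_apply, map_neg, ad_apply, hd, hj, hdd,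
      zero_smul, add_zero, LinearMap.zero_apply, smul_zero, neg_zero, smul_add, hs, smul_neg,
      LinearMap.neg_apply, LinearMap.smul_apply]
    abel
  · simp [curv, affine]

/-- the induced bilinear map on the quotients -/
def curvQ (N : ℕ) : AffQuot (g.adic 1) N →ₗ[ℚ] AffQuot (g.adic 1) N →ₗ[ℚ] AffQuot (g.adic 2) N :=
  ((affFil (g.adic 1) (N + 1)).liftQ
    ((affFil (g.adic 1) (N + 1)).liftQ (g.curv.compr₂ (affFil (g.adic 2) (N + 1)).mkQ)
      (fun p hp => LinearMap.ext fun q =>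
        (Submodule.Quotient.mk_eq_zero _).2 (g.curv_mem N p q hp).1)).flip
    (fun p hp => Submodule.linearMap_qext _ (LinearMap.ext fun q =>
      (Submodule.Quotient.mk_eq_zero _).2 (g.curv_mem N p q hp).2))).flip

lemma curvQ_mk (N : ℕ) (p q : g.formal.V 1 × ℚ) :
    g.curvQ N (Submodule.Quotient.mk p) (Submodule.Quotient.mk q) =
      Submodule.Quotient.mk (g.curv p q) := rfl

lemma curvQ_exp (N : ℕ) (x : g.formal.V 0) (m m' : AffQuot (g.adic 1) N)
    (h0 : ∀ x y : g.formal.V 0, (0 : g.formal.V 0 →ₗ[ℚ] g.formal.V 2) ⁅x, y⁆ =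
      g.formal.ad 2 x ((0 : g.formal.V 0 →ₗ[ℚ] g.formal.V 2) y) -
        g.formal.ad 2 y ((0 : g.formal.V 0 →ₗ[ℚ] g.formal.V 2) x)) :
    g.curvQ N (IsNilpotent.exp (trunc g.formal.negD_lie N x) m)
        (IsNilpotent.exp (trunc g.formal.negD_lie N x) m') =
      IsNilpotent.exp (trunc h0 N x) (g.curvQ N m m') := by
  set T := trunc g.formal.negD_lie N x with hT
  have hn : IsNilpotent T := ⟨N + 1, affTrunc_pow _ _ N x⟩
  have hn' : IsNilpotent (trunc h0 N x) := ⟨N + 1, affTrunc_pow _ _ N x⟩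
  refine (exp_bilin (g.curvQ N) hn hn' (fun p q => ?_) m m').symm
  obtain ⟨p, rfl⟩ := Submodule.Quotient.mk_surjective _ p
  obtain ⟨q, rfl⟩ := Submodule.Quotient.mk_surjective _ q
  rw [hT, curvQ_mk, affTrunc_mk, affTrunc_mk, affTrunc_mk, curvQ_mk, curvQ_mk, ← curv_affine]
  rfl

lemma curv_eq_zero_iff (ξ : g.formal.V 1) : g.curv (ξ, 1) (ξ, 1) = 0 ↔
    g.formal.d 1 2 rfl ξ + (2⁻¹ : ℚ) • g.formal.bracket 1 1 2 rfl ξ ξ = 0 := by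
  have : g.curv (ξ, 1) (ξ, 1) =
      ((2 : ℚ) • (g.formal.d 1 2 rfl ξ + (2⁻¹ : ℚ) • g.formal.bracket 1 1 2 rfl ξ ξ), 0) := by
    ext1
    · simp only [curv, LinearMap.mk₂_apply, one_smul, smul_add, smul_smul]
      rw [two_smul]; norm_num; abel
    · simp [curv]
  rw [this, Prod.mk_eq_zero, smul_eq_zero]
  simp

lemma act_mc {g : DGLA.{u, v} k} (a : Gauge g) (ξ : MC g.formal) :
    g.formal.d 1 2 rfl (a.act ξ.1) +
      (2⁻¹ : ℚ) • g.formal.bracket 1 1 2 rfl (a.act ξ.1) (a.act ξ.1) = 0 := by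
  rw [← curv_eq_zero_iff]
  have h0 := (g.curv_eq_zero_iff ξ.1).2 ξ.2
  ext1
  · refine formal_ext fun N => ?_
    have h := g.curvQ_exp N a.val (Submodule.Quotient.mk (ξ.1, 1)) (Submodule.Quotient.mk (ξ.1, 1))
      (by simp)
    rw [exp_trunc_mk, curvQ_mk, curvQ_mk, h0, Submodule.Quotient.mk_zero, map_zero,
      Submodule.Quotient.mk_eq_zero] at h
    rw [h.1 N le_rfl]
    exact (map_zero _).symm
  · simp [curv]

end Curvature

/-- the gauge action on the Maurer-Cartan elements of `λ g⟦λ⟧` -/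
noncomputable instance (g : DGLA.{u, v} k) : MulAction (Gauge g) (MC g.formal) where
  smul a ξ := ⟨a.act ξ.1, act_mc a ξ⟩
  one_smul ξ := Subtype.ext (one_act ξ.1)
  mul_smul a b ξ := Subtype.ext (mul_act a b ξ.1)

lemma smul_val {g : DGLA.{u, v} k} (a : Gauge g) (ξ : MC g.formal) :
    (a • ξ).1 = a.act ξ.1 := rfl

end DGLA
end ConDef

namespace ConDef
open CategoryTheory

universe u v

/-! ### Functoriality -/

lemma nest_map {L L' : Type*} [LieRing L] [LieAlgebra ℚ L] [LieRing L'] [LieAlgebra ℚ L']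
    (f : L →ₗ[ℚ] L') (hf : ∀ x y, f ⁅x, y⁆ = ⁅f x, f y⁆) (x y : L) (w : FreeAlgebra ℚ Bool) :
    f (nest x y w) = nest (f x) (f y) w := by
  have key : ∀ p : L × ℚ,
      Prod.map f id (FreeAlgebra.lift ℚ (fun b : Bool => prepend (cond b y x)) w p) =
        FreeAlgebra.lift ℚ (fun b : Bool => prepend (cond b (f y) (f x))) w (Prod.map f id p) := by
    induction w using FreeAlgebra.induction with
    | grade0 r =>
      intro p
      simp only [Algebra.algebraMap_eq_smul_one, map_smul, map_one, LinearMap.smul_apply,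
        Module.End.one_apply]
      ext <;> simp
    | grade1 b => intro p; cases b <;> simp [prepend, hf]
    | mul a b ha hb => intro p; rw [map_mul, map_mul, Module.End.mul_apply, ha, hb,
        Module.End.mul_apply]
    | add a b ha hb =>
      intro p
      rw [map_add, map_add, LinearMap.add_apply, LinearMap.add_apply, ← ha, ← hb]
      ext <;> simp
  have := congrArg Prod.fst (key (0, 1))
  simpa [nest] using this

variable {k : Type u} [CommRing k]

section

variable [Algebra ℚ k]

namespace DGLA

variable {g h : DGLA.{u, v} k} (φ : g ⟶ h)

lemma formalMap_bch (x y : g.formal.V 0) :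
    Hom.f (formalMap φ) 0 (bch x y) = bch (Hom.f (formalMap φ) 0 x) (Hom.f (formalMap φ) 0 y) := by
  refine formal_ext fun N => ?_
  rw [coeff_formalMap, bch, bch, coeff_mkSeries, coeff_mkSeries, map_sum]
  refine Finset.sum_congr rfl fun n _ => ?_
  rw [← coeff_formalMap, bchTerm, bchTerm, map_rat_smul]
  have := nest_map ((Hom.f (formalMap φ) 0).restrictScalars ℚ)
    (fun x y => (formalMap φ).map_bracket 0 0 0 rfl x y) x y (bchWord n)
  simp only [LinearMap.restrictScalars_apply] at this
  rw [this]

/-- the induced morphism of gauge groups -/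
noncomputable def Gauge.map : Gauge g →* Gauge h where
  toFun a := ⟨Hom.f (formalMap φ) 0 a.val⟩
  map_one' := Gauge.ext (map_zero _)
  map_mul' a b := Gauge.ext (formalMap_bch φ a.val b.val)

lemma Gauge.map_val (a : Gauge g) : (Gauge.map φ a).val = Hom.f (formalMap φ) 0 a.val := rfl

lemma formalMap_act (a : Gauge g) (ξ : g.formal.V 1) : Hom.f (formalMap φ) 1 (a.act ξ) =
    (Gauge.map φ a).act (Hom.f (formalMap φ) 1 ξ) := by
  have hp : ∀ (j : ℕ) (η : g.formal.V 1), Hom.f (formalMap φ) 1 ((g.formal.ad 1 a.val ^ j) η) =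
      (h.formal.ad 1 (Gauge.map φ a).val ^ j) (Hom.f (formalMap φ) 1 η) := by
    intro j η
    induction j with
    | zero => rfl
    | succ j ih =>
      rw [pow_succ', Module.End.mul_apply, pow_succ', Module.End.mul_apply, ← ih, ad_apply,
        ad_apply, (formalMap φ).map_bracket]
      rfl
  refine formal_ext fun N => ?_
  rw [coeff_formalMap, Gauge.act, Gauge.act, coeff_mkSeries, coeff_mkSeries, ← coeff_formalMap,
    map_sub, map_sum, map_sum]
  simp only [map_rat_smul, hp, (formalMap φ).map_d]
  rfl

/-- the induced map on Maurer-Cartan elements -/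
def MC.map (ξ : MC g) : MC h :=
  ⟨Hom.f φ 1 ξ.1, by
    rw [← φ.map_d, ← φ.map_bracket, ← map_rat_smul (Hom.f φ 2), ← map_add, ξ.2, map_zero]⟩

lemma MC.map_smul (a : Gauge g) (ξ : MC g.formal) :
    MC.map (formalMap φ) (a • ξ) = Gauge.map φ a • MC.map (formalMap φ) ξ :=
  Subtype.ext (formalMap_act φ a ξ.1)

/-- The set `Def(g)` of gauge equivalence classes of Maurer-Cartan elements of `λ g⟦λ⟧`: the orbit
space of the gauge action. -/
abbrev Def (g : DGLA.{u, v} k) : Type v := MulAction.orbitRel.Quotient (Gauge g) (MC g.formal)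

/-- the class of a Maurer-Cartan element -/
noncomputable def Def.mk (ξ : MC g.formal) : Def g := Quotient.mk'' ξ

lemma Def.mk_eq_iff {ξ η : MC g.formal} : Def.mk ξ = Def.mk η ↔ ∃ a : Gauge g, a • η = ξ :=
  Quotient.eq''.trans Iff.rfl

/-- the induced map on equivalence classes -/
noncomputable def Def.map : Def g → Def h :=
  Quotient.map' (MC.map (formalMap φ)) fun ξ η hξ => by
    obtain ⟨a, ha⟩ := hξ
    exact ⟨Gauge.map φ a, by rw [← ha]; exact (MC.map_smul φ a η).symm⟩

lemma Def.map_mk (ξ : MC g.formal) : Def.map φ (Def.mk ξ) = Def.mk (MC.map (formalMap φ) ξ) := rfl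

end DGLA

end

/-! ### Constraint objects and their reduction -/

/-- Constraint sets: a map `ι` from a set `N` to a set `T`, and an equivalence relation on `N`. -/
structure ConSet where
  T : Type v
  N : Type v
  ι : N → T
  rel : Setoid N

namespace ConSet

@[ext]
structure Hom (X Y : ConSet.{v}) where
  T : X.T → Y.T
  N : X.N → Y.N
  comm : ∀ x, T (X.ι x) = Y.ι (N x)
  map_rel : ∀ x y, X.rel x y → Y.rel (N x) (N y)

instance : Category ConSet.{v} where
  Hom := Hom
  id X := ⟨id, id, fun _ => rfl, fun _ _ h => h⟩
  comp f g := ⟨g.T ∘ f.T, g.N ∘ f.N, fun x => by simp [f.comm, g.comm],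
    fun x y h => g.map_rel _ _ (f.map_rel _ _ h)⟩

/-- reduction of constraint sets: `X ↦ X.N / ∼` -/
def red : ConSet.{v} ⥤ Type v where
  obj X := Quotient X.rel
  map f := TypeCat.ofHom (Quotient.map f.N fun x y h => f.map_rel x y h)
  map_id X := by ext x; induction x using Quotient.inductionOn; rfl
  map_comp f g := by ext x; induction x using Quotient.inductionOn; rfl

end ConSet

/-- Constraint groups: a group homomorphism `ι` from `N` to `T` and a normal subgroup of `N`. -/
structure ConGrp where
  T : Type v
  N : Type v
  [groupT : Group T]
  [groupN : Group N]
  ι : N →* T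
  zero : Subgroup N
  [normal : zero.Normal]

attribute [instance] ConGrp.groupT ConGrp.groupN ConGrp.normal

namespace ConGrp

@[ext]
structure Hom (G H : ConGrp.{v}) where
  T : G.T →* H.T
  N : G.N →* H.N
  comm : ∀ x, T (G.ι x) = H.ι (N x)
  map_zero : ∀ x ∈ G.zero, N x ∈ H.zero

instance : Category ConGrp.{v} where
  Hom := Hom
  id X := ⟨MonoidHom.id _, MonoidHom.id _, fun _ => rfl, fun _ h => h⟩
  comp f g := ⟨g.T.comp f.T, g.N.comp f.N, fun x => by simp [f.comm, g.comm],
    fun x h => g.map_zero _ (f.map_zero _ h)⟩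

/-- reduction of constraint groups: the quotient of `G.N` by the normal subgroup -/
def red : ConGrp.{v} ⥤ GrpCat.{v} where
  obj G := GrpCat.of (G.N ⧸ G.zero)
  map {G H} f := GrpCat.ofHom (QuotientGroup.map G.zero H.zero f.N f.map_zero)
  map_id G := by ext x; rfl
  map_comp f g := by ext x; rfl

end ConGrp

/-- Constraint DGLAs: a morphism `ι` of DGLAs from `N` to `T` and a differential graded Lie ideal
`zero` of `N`. -/
structure ConDGLA (k : Type u) [CommRing k] where
  T : DGLA.{u, v} k
  N : DGLA.{u, v} k
  ι : N ⟶ T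
  zero : ∀ i, Submodule k (N.V i)
  d_mem : ∀ (i j : ℤ) (h : i + 1 = j), ∀ x ∈ zero i, N.d i j h x ∈ zero j
  bracket_mem : ∀ (i j n : ℤ) (h : i + j = n) (x : N.V i), ∀ y ∈ zero j,
    N.bracket i j n h x y ∈ zero n

namespace ConDGLA

@[ext]
structure Hom (g h : ConDGLA.{u, v} k) where
  T : g.T ⟶ h.T
  N : g.N ⟶ h.N
  comm : g.ι ≫ T = N ≫ h.ι
  map_zero : ∀ i, ∀ x ∈ g.zero i, DGLA.Hom.f N i x ∈ h.zero i

instance : Category (ConDGLA.{u, v} k) where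
  Hom := Hom
  id X := ⟨𝟙 _, 𝟙 _, by simp, fun _ _ h => h⟩
  comp f g := ⟨f.T ≫ g.T, f.N ≫ g.N, by
    rw [← Category.assoc, f.comm, Category.assoc, g.comm, Category.assoc],
    fun i x h => g.map_zero i _ (f.map_zero i x h)⟩

lemma bracket_mem' (g : ConDGLA.{u, v} k) (i j n : ℤ) (h : i + j = n) (x : g.N.V i)
    (hx : x ∈ g.zero i) (y : g.N.V j) : g.N.bracket i j n h x y ∈ g.zero n := by
  rw [g.N.skew i j n h x y]
  refine Submodule.neg_mem _ ?_
  rcases Int.units_eq_one_or (i * j).negOnePow with e | e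
  · rw [e, one_smul]; exact g.bracket_mem _ _ _ _ _ _ hx
  · rw [e, Units.neg_smul, one_smul]
    exact Submodule.neg_mem _ (g.bracket_mem _ _ _ _ _ _ hx)

/-- the bracket on the quotients -/
def redBracket (g : ConDGLA.{u, v} k) (i j n : ℤ) (h : i + j = n) :
    (g.N.V i ⧸ g.zero i) →ₗ[k] (g.N.V j ⧸ g.zero j) →ₗ[k] (g.N.V n ⧸ g.zero n) :=
  ((g.zero j).liftQ
    ((g.zero i).liftQ ((g.N.bracket i j n h).compr₂ (g.zero n).mkQ)
      (fun x hx => LinearMap.ext fun y =>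
        (Submodule.Quotient.mk_eq_zero _).2 (g.bracket_mem' i j n h x hx y))).flip
    (fun y hy => Submodule.linearMap_qext _ (LinearMap.ext fun x =>
      (Submodule.Quotient.mk_eq_zero _).2 (g.bracket_mem i j n h x y hy)))).flip

lemma redBracket_mk (g : ConDGLA.{u, v} k) (i j n : ℤ) (h : i + j = n) (x : g.N.V i)
    (y : g.N.V j) : g.redBracket i j n h (Submodule.Quotient.mk x) (Submodule.Quotient.mk y) =
      Submodule.Quotient.mk (g.N.bracket i j n h x y) := rfl

/-- the reduced DGLA `g.N / g.zero` -/
def redObj (g : ConDGLA.{u, v} k) : DGLA.{u, v} k where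
  V i := g.N.V i ⧸ g.zero i
  d i j h := (g.zero i).mapQ (g.zero j) (g.N.d i j h) (g.d_mem i j h)
  bracket := g.redBracket
  d_d i j l hij hjl x := by
    obtain ⟨x, rfl⟩ := Submodule.Quotient.mk_surjective _ x
    rw [Submodule.mapQ_apply, Submodule.mapQ_apply, g.N.d_d, Submodule.Quotient.mk_zero]
  d_bracket i j n i' j' n' hn hi hj hn' x y := by
    obtain ⟨x, rfl⟩ := Submodule.Quotient.mk_surjective _ x
    obtain ⟨y, rfl⟩ := Submodule.Quotient.mk_surjective _ y
    rw [redBracket_mk, Submodule.mapQ_apply, g.N.d_bracket i j n i' j' n' hn hi hj hn']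
    rfl
  skew i j n hn x y := by
    obtain ⟨x, rfl⟩ := Submodule.Quotient.mk_surjective _ x
    obtain ⟨y, rfl⟩ := Submodule.Quotient.mk_surjective _ y
    rw [redBracket_mk, g.N.skew i j n hn]
    rfl
  jacobi i j l ij jl il n hij hjl hil hn x y z := by
    obtain ⟨x, rfl⟩ := Submodule.Quotient.mk_surjective _ x
    obtain ⟨y, rfl⟩ := Submodule.Quotient.mk_surjective _ y
    obtain ⟨z, rfl⟩ := Submodule.Quotient.mk_surjective _ z
    rw [redBracket_mk, redBracket_mk, g.N.jacobi i j l ij jl il n hij hjl hil hn]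
    rfl

/-- the quotient morphism -/
def proj (g : ConDGLA.{u, v} k) : g.N ⟶ g.redObj where
  f i := (g.zero i).mkQ
  map_d _ _ _ _ := rfl
  map_bracket _ _ _ _ _ _ := rfl

/-- reduction of constraint DGLAs -/
def red (k : Type u) [CommRing k] : ConDGLA.{u, v} k ⥤ DGLA.{u, v} k where
  obj := redObj
  map {g h} φ :=
    { f := fun i => (g.zero i).mapQ (h.zero i) (DGLA.Hom.f φ.N i) (φ.map_zero i)
      map_d := fun i j hij x => by
        obtain ⟨x, rfl⟩ := Submodule.Quotient.mk_surjective _ x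
        exact congrArg Submodule.Quotient.mk (φ.N.map_d i j hij x)
      map_bracket := fun i j n hn x y => by
        obtain ⟨x, rfl⟩ := Submodule.Quotient.mk_surjective _ x
        obtain ⟨y, rfl⟩ := Submodule.Quotient.mk_surjective _ y
        exact congrArg Submodule.Quotient.mk (φ.N.map_bracket i j n hn x y) }
  map_id g := by
    refine DGLA.Hom.ext (funext fun i => Submodule.linearMap_qext _ (LinearMap.ext fun x => ?_))
    rfl
  map_comp φ ψ := by
    refine DGLA.Hom.ext (funext fun i => Submodule.linearMap_qext _ (LinearMap.ext fun x => ?_))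
    rfl

/-- the constraint DGLA `λ g⟦λ⟧ = (λ g.T⟦λ⟧, λ g.N⟦λ⟧, λ g.zero⟦λ⟧)` -/
def formal (g : ConDGLA.{u, v} k) : ConDGLA.{u, v} k where
  T := g.T.formal
  N := g.N.formal
  ι := DGLA.formalMap g.ι
  zero i :=
    { carrier := {x | ∀ n, DGLA.coeff n x ∈ g.zero i}
      add_mem' := fun hx hy n => by rw [map_add]; exact Submodule.add_mem _ (hx n) (hy n)
      zero_mem' := fun n => by rw [map_zero]; exact Submodule.zero_mem _
      smul_mem' := fun c x hx n => by rw [map_smul]; exact Submodule.smul_mem _ c (hx n) }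
  d_mem i j h x hx n := g.d_mem i j h _ (hx n)
  bracket_mem i j n h x y hy m := by
    rw [DGLA.coeff_bracket]
    exact Submodule.sum_mem _ fun p _ => g.bracket_mem i j n h _ _ (hy p.2)

end ConDGLA

/-! ### The functors `MC`, `G` and `Def` -/

section Functors

variable (k) [Algebra ℚ k]

/-- the Maurer-Cartan functor on DGLAs -/
def MC : DGLA.{u, v} k ⥤ Type v where
  obj g := DGLA.MC g
  map φ := TypeCat.ofHom (DGLA.MC.map φ)
  map_id _ := rfl
  map_comp _ _ := rfl

/-- the gauge group functor on DGLAs -/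
noncomputable def G : DGLA.{u, v} k ⥤ GrpCat.{v} where
  obj g := GrpCat.of (DGLA.Gauge g)
  map φ := GrpCat.ofHom (DGLA.Gauge.map φ)
  map_id _ := rfl
  map_comp _ _ := rfl

/-- the deformation functor on DGLAs -/
noncomputable def Def : DGLA.{u, v} k ⥤ Type v where
  obj g := DGLA.Def g
  map φ := TypeCat.ofHom (DGLA.Def.map φ)
  map_id g := by ext q; induction q using Quotient.inductionOn'; rfl
  map_comp φ ψ := by ext q; induction q using Quotient.inductionOn'; rfl

variable {k}

namespace ConDGLA

/-- The constraint set `(MC(g.T), MC(g.N), ∼)` of Maurer-Cartan elements, with `ξ ∼ η` if and only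
if `ξ - η` lies in `g.zero`. -/
def mc (g : ConDGLA.{u, v} k) : ConSet.{v} where
  T := DGLA.MC g.T
  N := DGLA.MC g.N
  ι := DGLA.MC.map g.ι
  rel :=
    { r := fun ξ η => ξ.1 - η.1 ∈ g.zero 1
      iseqv :=
        ⟨fun ξ => by rw [sub_self]; exact Submodule.zero_mem _,
          fun h => by rw [← neg_sub]; exact Submodule.neg_mem _ h,
          fun h h' => by rw [← sub_add_sub_cancel]; exact Submodule.add_mem _ h h'⟩ }

lemma mc_rel (g : ConDGLA.{u, v} k) (ξ η : DGLA.MC g.N) :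
    g.mc.rel ξ η ↔ ξ.1 - η.1 ∈ g.zero 1 := Iff.rfl

lemma formal_mc_rel (g : ConDGLA.{u, v} k) (ξ η : DGLA.MC g.N.formal) :
    (∀ n, DGLA.coeff n (ξ.1 - η.1) ∈ g.zero 1) ↔
      DGLA.MC.map (DGLA.formalMap g.proj) ξ = DGLA.MC.map (DGLA.formalMap g.proj) η := by
  constructor
  · refine fun h => Subtype.ext (DGLA.formal_ext fun n => ?_)
    have := h n
    rw [map_sub] at this
    exact (Submodule.Quotient.eq _).2 this
  · intro h n
    have := congrArg (fun ζ => DGLA.coeff n ζ.1) h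
    rw [map_sub]
    exact (Submodule.Quotient.eq _).1 this

/-- the gauge action of the `N`-component is compatible with the relation `∼` -/
lemma smul_rel (g : ConDGLA.{u, v} k) (a : DGLA.Gauge g.N) {ξ η : DGLA.MC g.N.formal}
    (h : ∀ n, DGLA.coeff n (ξ.1 - η.1) ∈ g.zero 1) (n : ℕ) :
    DGLA.coeff n ((a • ξ).1 - (a • η).1) ∈ g.zero 1 :=
  (formal_mc_rel g _ _).2 (by
    rw [DGLA.MC.map_smul, DGLA.MC.map_smul, (formal_mc_rel g _ _).1 h]) n

/-- The constraint group `(λ g.T⁰⟦λ⟧, λ g.N⁰⟦λ⟧, λ g.zero⁰⟦λ⟧)` with the Baker-Campbell-Hausdorff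
multiplication. -/
noncomputable def gauge (g : ConDGLA.{u, v} k) : ConGrp.{v} where
  T := DGLA.Gauge g.T
  N := DGLA.Gauge g.N
  ι := DGLA.Gauge.map g.ι
  zero := (DGLA.Gauge.map g.proj).ker.copy {a | a.val ∈ g.formal.zero 0} (by
    ext a
    rw [SetLike.mem_coe, MonoidHom.mem_ker]
    constructor
    · exact fun h => DGLA.Gauge.ext (DGLA.formal_ext fun n =>
        (Submodule.Quotient.mk_eq_zero _).2 (h n))
    · intro h n
      have := congrArg (fun b => DGLA.coeff n b.val) h
      exact (Submodule.Quotient.mk_eq_zero _).1 (this.trans (map_zero _)))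
  normal := by rw [Subgroup.copy_eq]; infer_instance

/-- The constraint set of equivalence classes of Maurer-Cartan elements: the orbit space of the
gauge action on `mc (λ g⟦λ⟧)`. Two orbits in the `N`-component are equivalent if they contain
equivalent Maurer-Cartan elements. -/
noncomputable def defSet (g : ConDGLA.{u, v} k) : ConSet.{v} where
  T := DGLA.Def g.T
  N := DGLA.Def g.N
  ι := DGLA.Def.map g.ι
  rel :=
    { r := fun p q => ∃ ξ η : DGLA.MC g.N.formal,
        DGLA.Def.mk ξ = p ∧ DGLA.Def.mk η = q ∧ g.formal.mc.rel ξ η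
      iseqv := by
        refine ⟨fun p => ?_, fun ⟨ξ, η, h, h', e⟩ => ⟨η, ξ, h', h, Setoid.symm' _ e⟩, ?_⟩
        · induction p using Quotient.inductionOn' with
          | h ξ => exact ⟨ξ, ξ, rfl, rfl, Setoid.refl' _ ξ⟩
        · rintro _ _ _ ⟨ξ, η, rfl, rfl, e⟩ ⟨η', ζ, h, rfl, e'⟩
          obtain ⟨a, rfl⟩ := DGLA.Def.mk_eq_iff.1 h.symm
          exact ⟨ξ, a • ζ, rfl, DGLA.Def.mk_eq_iff.2 ⟨a, rfl⟩,
            Setoid.trans' _ e (g.smul_rel a e')⟩ }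

end ConDGLA

variable (k)

/-- the constraint Maurer-Cartan functor -/
def conMC : ConDGLA.{u, v} k ⥤ ConSet.{v} where
  obj g := g.mc
  map {g h} φ :=
    { T := DGLA.MC.map φ.T
      N := DGLA.MC.map φ.N
      comm := fun ξ => congrArg (fun f => DGLA.MC.map f ξ) φ.comm
      map_rel := fun ξ η e => by
        have := φ.map_zero 1 _ e
        rwa [map_sub] at this }
  map_id _ := rfl
  map_comp _ _ := rfl

/-- the constraint gauge group functor -/
noncomputable def conG : ConDGLA.{u, v} k ⥤ ConGrp.{v} where
  obj g := g.gauge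
  map {g h} φ :=
    { T := DGLA.Gauge.map φ.T
      N := DGLA.Gauge.map φ.N
      comm := fun a => congrArg (fun f => DGLA.Gauge.map f a) φ.comm
      map_zero := fun a ha n => φ.map_zero 0 _ (ha n) }
  map_id _ := rfl
  map_comp _ _ := rfl

/-- the constraint deformation functor -/
noncomputable def conDef : ConDGLA.{u, v} k ⥤ ConSet.{v} where
  obj g := g.defSet
  map {g h} φ :=
    { T := DGLA.Def.map φ.T
      N := DGLA.Def.map φ.N
      comm := fun p => by
        induction p using Quotient.inductionOn' with
        | h ξ => exact congrArg (fun f => DGLA.Def.map f (DGLA.Def.mk ξ)) φ.comm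
      map_rel := by
        rintro _ _ ⟨ξ, η, rfl, rfl, e⟩
        refine ⟨DGLA.MC.map (DGLA.formalMap φ.N) ξ, DGLA.MC.map (DGLA.formalMap φ.N) η,
          rfl, rfl, fun n => ?_⟩
        have he : DGLA.coeff n (ξ.1 - η.1) ∈ g.zero 1 := e n
        have hφ := φ.map_zero 1 _ he
        rw [map_sub, map_sub] at hφ
        have hs := map_sub (DGLA.coeff n) (DGLA.MC.map (DGLA.formalMap φ.N) ξ).1
          (DGLA.MC.map (DGLA.formalMap φ.N) η).1
        exact (congrArg (· ∈ h.zero 1) hs).mpr hφ }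
  map_id g := by
    refine ConSet.Hom.ext (funext fun p => ?_) (funext fun p => ?_) <;>
    · induction p using Quotient.inductionOn'; rfl
  map_comp φ ψ := by
    refine ConSet.Hom.ext (funext fun p => ?_) (funext fun p => ?_) <;>
    · induction p using Quotient.inductionOn'; rfl

end Functors

end ConDef

open CategoryTheory ConDef

universe u v

/-! Everything rests on the quotient morphism `g.proj : g.N ⟶ g.redObj`. It is natural in the
constraint DGLA `g`: a morphism `φ` acts on the reduction by applying `φ.N` to representatives.
Reduction of constraint sets and groups involves only the `N`-component, so applying `MC`, `G` or
`Def` to `g.proj` gives a natural map out of the `N`-component of the constraint object. In all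
three cases it remains to identify the fibres of this map: they must be exactly the classes that
reduction collapses. One half says that the map descends to the reduction, the other that the
descended map is injective.

For `MC` the fibres are immediate, since two degree one elements have equal image in the quotient
exactly when they differ by an element of the ideal (`mc_rel_iff`). For `G`, a series maps to zero
exactly when every coefficient lies in the ideal, so the kernel is the distinguished normal subgroup
(`mem_gauge_zero_iff`). The map is also onto (`gaugeMap_proj_surjective`), because a series lifts
coefficient by coefficient and an element of the gauge group has no equation to satisfy. The first
isomorphism theorem then gives the isomorphism of groups.

The case of `Def` combines the two (`defSet_rel_iff`). Suppose that the images of `ξ` and `η` are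
related by a gauge transformation of the reduction. Lift this transformation to `a` over `g.N`. By
equivariance `a • η` has the same image as `ξ`, so the two differ by a series with coefficients in
the ideal, and `a • η` still represents the orbit of `η`. Without lifts of gauge transformations,
orbits could become identified in the reduction for no reason visible in `g.N`.

Maurer-Cartan elements, in contrast, need not lift: the curvature of a lift is only known to lie in
the ideal. Let `g.N` be `k` in degrees one and two, with zero bracket and with the identity as
differential, and let the ideal be the degree two part. If `k` is nonzero, then zero is the only
Maurer-Cartan element of `g.N`, while every degree one element of the reduction is one. The same
happens for series, where the gauge groups are trivial. Hence the comparisons for `MC` and `Def` are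
injective but in general not surjective. -/

namespace ConDef

variable {k : Type u} [CommRing k] [Algebra ℚ k]

/-! ### Lifting gauge transformations along surjections -/

namespace DGLA

/-- The gauge group is the whole of the degree zero series as a set, so the Baker-Campbell-Hausdorff
product puts no condition on a preimage and the coefficients can be lifted independently of each
other. Only the degree zero component of `φ` matters. -/
lemma Gauge.map_surjective {g h : DGLA.{u, v} k} {φ : g ⟶ h}
    (hφ : Function.Surjective (Hom.f φ 0)) : Function.Surjective (Gauge.map φ) := by
  intro a
  choose b hb using fun n => hφ (coeff n a.val)
  -- The chosen preimage `b 0` of zero may be a nonzero element of the kernel. It is replaced by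
  -- zero, as the lift must have no constant term.
  have h : ∀ n, Hom.f φ 0 (if n = 0 then 0 else b n) = coeff n a.val := by
    intro n
    split_ifs with hn
    · rw [hn, coeff_zero, map_zero]
    · exact hb n
  exact ⟨⟨mkSeries (fun n => if n = 0 then 0 else b n) (if_pos rfl)⟩,
    Gauge.ext (formal_ext h)⟩

end DGLA

/-! ### Fibres of the maps induced by the quotient morphism -/

namespace ConDGLA

/-- The source of surjectivity in the comparison of gauge groups, and of injectivity in the
comparison of deformation sets. -/
lemma gaugeMap_proj_surjective (g : ConDGLA.{u, v} k) :
    Function.Surjective (DGLA.Gauge.map g.proj) :=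
  DGLA.Gauge.map_surjective (Submodule.mkQ_surjective (g.zero 0))

/-- Being Maurer-Cartan is a property, so equality of images is equality of the underlying classes
modulo `g.zero 1`. Read forwards this makes the comparison map for `MC` well defined, read backwards
it makes it injective. -/
lemma mc_rel_iff (g : ConDGLA.{u, v} k) (ξ η : DGLA.MC g.N) :
    g.mc.rel ξ η ↔ DGLA.MC.map g.proj ξ = DGLA.MC.map g.proj η :=
  ⟨fun e => Subtype.ext ((Submodule.Quotient.eq (g.zero 1)).2 e),
    fun e => (Submodule.Quotient.eq (g.zero 1)).1 (congrArg Subtype.val e)⟩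

/-- The crux for deformation sets. A gauge equivalence in the reduction lifts to `g.N`, and moving
one representative along the lift turns equivalence of the images into equality of the images, where
`formal_mc_rel` applies. That lemma compares coefficients directly in the series over `g.redObj`, so
the reduction of the series DGLA need not be identified with the series over the reduction. -/
lemma defSet_rel_iff (g : ConDGLA.{u, v} k) (p q : DGLA.Def g.N) :
    g.defSet.rel p q ↔ DGLA.Def.map g.proj p = DGLA.Def.map g.proj q := by
  constructor
  · rintro ⟨ξ, η, rfl, rfl, e⟩
    exact congrArg DGLA.Def.mk ((formal_mc_rel g ξ η).1 e)
  · induction p using Quotient.inductionOn' with | h ξ => ?_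
    induction q using Quotient.inductionOn' with | h η => ?_
    intro e
    -- Here `a` is a gauge transformation of the reduction and carries the image of `η` to the image
    -- of `ξ`; the next line replaces it by a lift.
    obtain ⟨a, ha⟩ := DGLA.Def.mk_eq_iff.1 e
    obtain ⟨a, rfl⟩ := g.gaugeMap_proj_surjective a
    -- The representative `ξ` is kept and `η` is moved within its orbit. By equivariance, `a • η`
    -- then has exactly the same image as `ξ`.
    refine ⟨ξ, a • η, rfl, DGLA.Def.mk_eq_iff.2 ⟨a, rfl⟩, (formal_mc_rel g _ _).2 ?_⟩
    rw [DGLA.MC.map_smul]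
    exact ha.symm

/-- The carrier of `g.gauge.zero` was fixed as the series with all coefficients in the ideal; this
recovers its description as a kernel. The neutral element of the gauge group is the zero series, so
the claim is checked one coefficient at a time. -/
lemma mem_gauge_zero_iff (g : ConDGLA.{u, v} k) (a : DGLA.Gauge g.N) :
    a ∈ g.gauge.zero ↔ DGLA.Gauge.map g.proj a = 1 :=
  ⟨fun h => DGLA.Gauge.ext (DGLA.formal_ext fun n => (Submodule.Quotient.mk_eq_zero _).2 (h n)),
    fun h n => (Submodule.Quotient.mk_eq_zero _).1
      (congrArg (fun b => DGLA.coeff n b.val) h)⟩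

/-- the group `G(g.N) / G(g.zero)` is the gauge group of the reduction of `g` -/
noncomputable def redGaugeEquiv (g : ConDGLA.{u, v} k) :
    g.gauge.N ⧸ g.gauge.zero ≃* DGLA.Gauge g.redObj :=
  MulEquiv.ofBijective
    -- First isomorphism theorem: the map descends because the subgroup lies in the kernel, and is
    -- injective because the kernel lies in the subgroup.
    (QuotientGroup.lift g.gauge.zero (DGLA.Gauge.map g.proj : g.gauge.N →* DGLA.Gauge g.redObj)
      fun a => (g.mem_gauge_zero_iff a).1)
    ⟨(injective_iff_map_eq_one _).2 fun p => by
        induction p using QuotientGroup.induction_on with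
        | H a => exact fun e =>
            (@QuotientGroup.eq_one_iff g.gauge.N _ g.gauge.zero g.gauge.normal a).2 ((g.mem_gauge_zero_iff a).2 e),
      -- A preimage of `b` in the class group is the class of a preimage in `g.gauge.N`; on classes
      -- the descended map is by definition the original one.
      fun b => (g.gaugeMap_proj_surjective b).imp' (QuotientGroup.mk (s := g.gauge.zero))
        fun _ h => h⟩

end ConDGLA

/-! ### The comparison transformations and their naturality -/

variable (k)

/-- the comparison of the reduction of Maurer-Cartan elements with the Maurer-Cartan elements of
the reduction -/
def redMC : conMC.{u, v} k ⋙ ConSet.red ⟶ ConDGLA.red k ⋙ MC k where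
  app g := TypeCat.ofHom (Quotient.lift (s := g.mc.rel) (DGLA.MC.map g.proj)
    fun ξ η => (g.mc_rel_iff ξ η).1)
  naturality g h φ := by
    ext p
    induction p using Quotient.inductionOn with
    -- Both composites send the class of `ξ` to the class of its image under `φ.N`, by the
    -- definition of `ConDGLA.red` on morphisms.
    | h ξ => rfl

lemma redMC_injective (g : ConDGLA.{u, v} k) : Function.Injective ((redMC k).app g) := by
  intro p q
  induction p using Quotient.inductionOn with | h ξ => ?_
  induction q using Quotient.inductionOn with | h η => ?_
  exact fun e => Quotient.sound ((g.mc_rel_iff ξ η).2 e)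

/-- reduction commutes with the gauge group functor -/
noncomputable def redG : conG.{u, v} k ⋙ ConGrp.red ≅ ConDGLA.red k ⋙ G k :=
  NatIso.ofComponents (fun g => g.redGaugeEquiv.toGrpIso) fun {g h} φ => by
    ext p
    induction p using QuotientGroup.induction_on with
    -- On a representative `a`, both composites apply `φ.N` to every coefficient and then pass to
    -- the quotient by the ideal.
    | H a => rfl

/-- the comparison of the reduction of equivalence classes of Maurer-Cartan elements with those of
the reduction -/
noncomputable def redDef : conDef.{u, v} k ⋙ ConSet.red ⟶ ConDGLA.red k ⋙ Def k where
  app g := TypeCat.ofHom (Quotient.lift (s := g.defSet.rel) (DGLA.Def.map g.proj)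
    fun p q => (g.defSet_rel_iff p q).1)
  naturality g h φ := by
    ext p
    -- There are two quotients to unwind: first the relation between orbits, then the gauge orbits
    -- themselves. On a Maurer-Cartan representative, naturality is again definitional.
    induction p using Quotient.inductionOn with | h p => ?_
    induction p using Quotient.inductionOn' with
    | h ξ => rfl

/-- Only the outer quotient is unwound here, since `defSet_rel_iff` is already a statement about
orbits. Its backward direction, the one that lifts gauge transformations, is what is used. -/
lemma redDef_injective (g : ConDGLA.{u, v} k) : Function.Injective ((redDef k).app g) := by
  intro p q
  induction p using Quotient.inductionOn with | h p => ?_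
  induction q using Quotient.inductionOn with | h q => ?_
  exact fun e => Quotient.sound ((g.defSet_rel_iff p q).2 e)

end ConDef

theorem mainTheorem5 (k : Type u) [CommRing k] [Algebra ℚ k] :
    (∃ η : conMC.{u, v} k ⋙ ConSet.red ⟶ ConDGLA.red k ⋙ MC k,
      ∀ g : ConDGLA.{u, v} k, Function.Injective (η.app g)) ∧
    Nonempty (conG.{u, v} k ⋙ ConGrp.red ≅ ConDGLA.red k ⋙ G k) ∧
    (∃ η : conDef.{u, v} k ⋙ ConSet.red ⟶ ConDGLA.red k ⋙ Def k,
      ∀ g : ConDGLA.{u, v} k, Function.Injective (η.app g)) :=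
  ⟨⟨redMC k, redMC_injective k⟩, ⟨redG k⟩, ⟨redDef k, redDef_injective k⟩⟩
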